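/- Let $\mathfrak S_2=\{Z=(z_1,z_2)\in\mathbb C^2: \rho(Z)>0\}$, where $\rho(Z,W)=\overline{z_1}+w_1-\overline{z_2}w_2$ and $\rho(Z)=\rho(Z,Z)=z_1+\overline{z_1}-z_2\overline{z_2}$. For $2k\in\mathbb Z$ let $$\Delta_k=\rho(Z)\left[(z_1+\overline{z_1})\frac{\partial^2}{\partial z_1\partial\overline{z_1}}+\frac{\partial^2}{\partial z_2\partial\overline{z_2}}+z_2\frac{\partial^2}{\partial\overline{z_1}\partial z_2}+\overline{z_2}\frac{\partial^2}{\partial z_1\partial\overline{z_2}}-k\left(\frac{\partial}{\partial z_1}-\frac{\partial}{\partial\overline{z_1}}\right)\right],$$ and for a complex-valued function $\Phi\in C_c^2(\mathbb R)$ put $$u(Z,W)=\frac{|\rho(Z,W)|^2}{\rho(Z)\rho(W)}-1,\qquad H_k(Z,W)=\frac{\rho(Z,W)^{2k}}{|\rho(Z,W)|^{2k}},\qquad K_k(Z,W)=H_k(Z,W)\,\Phi(u(Z,W)).$$ Let $dm(W)=\rho(W)^{-3}\,dw_1\,d\overline{w_1}\,dw_2\,d\overline{w_2}$ be the $SU(2,1)$-invariant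 measure on $\mathfrak S_2$, where $dw\,d\overline{w}$ denotes twice Lebesgue measure on $\mathbb C$. Theorem 2.5. For every $\Phi\in C_c^2(\mathbb R)$, every $k$ with $2k\in\mathbb Z$ and every $\lambda\in\mathbb C$ there is a number $\Lambda_k(\lambda)\in\mathbb C$, depending only on $(\Phi,k,\lambda)$, such that for every $f\in C^2(\mathfrak S_2)$ (real $C^2$, complex-valued) with $\Delta_k f=\lambda f$ on $\mathfrak S_2$ and every $Z\in\mathfrak S_2$, the function $W\mapsto K_k(Z,W)f(W)$ is integrable with respect to $dm$ and $$L_kf(Z):=\int_{\mathfrak S_2}K_k(Z,W)f(W)\,dm(W)=\Lambda_k(\lambda)\,f(Z).$$ In particular $\Lambda_k(\lambda)$ does not depend on $f$. -/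

import Mathlib

namespace SU21

open MeasureTheory

/-- The polarized form `ρ(Z, W) = conj z₁ + w₁ - conj z₂ * w₂` on `ℂ²`. -/
noncomputable def rhoPair (Z W : ℂ × ℂ) : ℂ :=
  (starRingEnd ℂ) Z.1 + W.1 - (starRingEnd ℂ) Z.2 * W.2

/-- The real number `ρ(Z) = z₁ + conj z₁ - z₂ * conj z₂`. -/
noncomputable def rho (Z : ℂ × ℂ) : ℝ := 2 * Z.1.re - Complex.normSq Z.2

/-- `ρ(Z) = ρ(Z, Z)`. -/
theorem rhoPair_self (Z : ℂ × ℂ) : rhoPair Z Z = (rho Z : ℂ) := by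
  apply Complex.ext
  · simp [rhoPair, rho, Complex.normSq_apply]; ring
  · simp [rhoPair, rho]; ring

/-- The Siegel domain `𝔖₂ = {(z₁, z₂) : z₁ + conj z₁ - z₂ * conj z₂ > 0}`. -/
def domain : Set (ℂ × ℂ) := {Z | 0 < rho Z}

/-- For the direction `v`, the operator `(1/2) (∂_v - i ∂_{iv})`; for `v` the `j`-th
coordinate vector this is the Wirtinger derivative `∂/∂z_j`. -/
noncomputable def wirtinger (v : ℂ × ℂ) (f : ℂ × ℂ → ℂ) (Z : ℂ × ℂ) : ℂ :=
  (fderiv ℝ f Z v - Complex.I * fderiv ℝ f Z (Complex.I • v)) / 2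

/-- For the direction `v`, the operator `(1/2) (∂_v + i ∂_{iv})`; for `v` the `j`-th
coordinate vector this is the Wirtinger derivative `∂/∂(conj z_j)`. -/
noncomputable def wirtingerBar (v : ℂ × ℂ) (f : ℂ × ℂ → ℂ) (Z : ℂ × ℂ) : ℂ :=
  (fderiv ℝ f Z v + Complex.I * fderiv ℝ f Z (Complex.I • v)) / 2

/-- The operator `∂/∂z₁`. -/
noncomputable def dz₁ : (ℂ × ℂ → ℂ) → ℂ × ℂ → ℂ := wirtinger (1, 0)

/-- The operator `∂/∂z₂`. -/
noncomputable def dz₂ : (ℂ × ℂ → ℂ) → ℂ × ℂ → ℂ := wirtinger (0, 1)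

/-- The operator `∂/∂(conj z₁)`. -/
noncomputable def dzbar₁ : (ℂ × ℂ → ℂ) → ℂ × ℂ → ℂ := wirtingerBar (1, 0)

/-- The operator `∂/∂(conj z₂)`. -/
noncomputable def dzbar₂ : (ℂ × ℂ → ℂ) → ℂ × ℂ → ℂ := wirtingerBar (0, 1)

/-- The weighted Laplace operator `Δ_k`. -/
noncomputable def laplacian (k : ℝ) (f : ℂ × ℂ → ℂ) (Z : ℂ × ℂ) : ℂ :=
  (rho Z : ℂ) *
    ((Z.1 + (starRingEnd ℂ) Z.1) * dz₁ (dzbar₁ f) Z + dz₂ (dzbar₂ f) Z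
      + Z.2 * dzbar₁ (dz₂ f) Z + (starRingEnd ℂ) Z.2 * dz₁ (dzbar₂ f) Z
      - (k : ℂ) * (dz₁ f Z - dzbar₁ f Z))

/-- The point-pair invariant `u(Z, W) = |ρ(Z, W)|² / (ρ(Z) ρ(W)) - 1`. -/
noncomputable def u (Z W : ℂ × ℂ) : ℝ := ‖rhoPair Z W‖ ^ 2 / (rho Z * rho W) - 1

/-- The factor `H_k(Z, W) = ρ(Z, W)^(2k) / |ρ(Z, W)|^(2k)`, where `m` is the integer `2k`. -/
noncomputable def H (m : ℤ) (Z W : ℂ × ℂ) : ℂ :=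
  rhoPair Z W ^ m / (‖rhoPair Z W‖ : ℂ) ^ m

/-- The kernel `K_k(Z, W) = H_k(Z, W) Φ(u(Z, W))`, where `m` is the integer `2k`. -/
noncomputable def K (Φ : ℝ → ℂ) (m : ℤ) (Z W : ℂ × ℂ) : ℂ := H m Z W * Φ (u Z W)

/-- The `SU(2,1)`-invariant measure `dm = ρ(Z)⁻³ dz₁ dz̄₁ dz₂ dz̄₂` on `𝔖₂`. Here `dz dz̄` stands
for twice Lebesgue measure on `ℂ`, which gives the factor `4`. -/
noncomputable def dm : Measure (ℂ × ℂ) :=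
  (volume.restrict domain).withDensity fun Z => ENNReal.ofReal (4 / rho Z ^ 3)

/-- The integral operator `L_k` with kernel `K_k`, where `m` is the integer `2k`. -/
noncomputable def L (Φ : ℝ → ℂ) (m : ℤ) (f : ℂ × ℂ → ℂ) (Z : ℂ × ℂ) : ℂ :=
  ∫ W, K Φ m Z W * f W ∂dm

end SU21

/-!
The Siegel domain is homogeneous, and the stabilizer of a point acts transitively on the level sets
of `u`. In the coordinates of the unit ball centred at `Z`, given by the Cayley transform
`cayley Z`, the point `Z` becomes the origin, `u` becomes `1 / (1 - |ζ|²) - 1`, the measure `dm`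
becomes `4 (1 - |ζ|²)⁻³ dζ`, and the factor `H_k` becomes a unimodular function `phase k` that is
absorbed into `f`: with `F = phase k · (f ∘ cayley Z)` (`pullback`), the operator `L f (Z)` is the
integral of `F` against a radial weight of compact support in the ball (`integrable_and_L_eq`), and
`Δ_k f = λ f` turns into the weighted invariant Laplace equation `BallEigenfunction` for `F`, which
commutes with rotations (`ballEigenfunction_pullback`).

The means of `F` over the spheres about the origin then satisfy a linear second-order differential
equation in the radius (`sphereMean_ode`). It is singular at `0`, and a solution that is regular there
is determined by its value at `0`, since the singular term is a damping term of the favourable sign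
(`eq_zero_of_damped_ode`). So an `F` with `F(0) = f(Z) = 0` has vanishing spherical means
(`sphereMean_eq_zero`) and vanishing integral against every radial weight
(`setIntegral_radial_mul_eq_zero`). Neither the weight nor the equation on the ball depends on `Z`, so
this applies to `F - c F₀` for the pullbacks of two eigenfunctions to two different base points, and
gives `L f (Z) / f (Z) = L f₀ (Z₀) / f₀ (Z₀)` (`L_mul_eq_L_mul`). This common ratio is `Λ_k(λ)`.

The means of the derivatives of `F` are computed without polar coordinates: along one-parameter groups
of rotations the mean of `F` is constant, and its second derivative in the parameter expresses the mean
of a tangential second derivative through that of the radial derivative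
(`sphereMean_second_tangential`).
-/

namespace SU21

open MeasureTheory Set Filter Topology ComplexConjugate

/-! ### Euclidean geometry of the ball and integration over the shell -/

/-- The squared Euclidean norm `|x₁|² + |x₂|²` on `ℂ²`. (The norm of the product type `ℂ × ℂ` is the
maximum norm, which is not invariant under rotations.) -/
noncomputable def nsq (x : ℂ × ℂ) : ℝ := Complex.normSq x.1 + Complex.normSq x.2

/-- The open Euclidean unit ball of `ℂ²`. -/
def unitBall : Set (ℂ × ℂ) := {x | nsq x < 1}

/-- The compact shell `1 ≤ |x|² ≤ 4`. Spherical means are taken over it, in the angular variable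
`dir x`, so that Lebesgue measure on `ℂ²` replaces the surface measure of the sphere. -/
def shell : Set (ℂ × ℂ) := {x | 1 ≤ nsq x ∧ nsq x ≤ 4}

/-- The direction `x / |x|` of a vector with respect to the Euclidean norm. -/
noncomputable def dir (x : ℂ × ℂ) : ℂ × ℂ := (√(nsq x))⁻¹ • x

theorem nsq_nonneg (x : ℂ × ℂ) : 0 ≤ nsq x :=
  add_nonneg (Complex.normSq_nonneg _) (Complex.normSq_nonneg _)

@[fun_prop]
theorem continuous_nsq : Continuous nsq := by
  unfold nsq
  fun_prop

theorem nsq_smul (r : ℝ) (x : ℂ × ℂ) : nsq (r • x) = r ^ 2 * nsq x := by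
  simp [nsq, Complex.normSq_apply]; ring

theorem nsq_zero : nsq 0 = 0 := by simp [nsq]

theorem isOpen_unitBall : IsOpen unitBall := isOpen_lt continuous_nsq continuous_const

theorem isCompact_nsq_le (R : ℝ) : IsCompact {x : ℂ × ℂ | nsq x ≤ R} := by
  refine Metric.isCompact_of_isClosed_isBounded (isClosed_le continuous_nsq continuous_const) ?_
  refine (Metric.isBounded_closedBall (x := (0 : ℂ × ℂ)) (r := R + 1)).subset fun x hx => ?_
  have h1 := Complex.normSq_nonneg x.1
  have h2 := Complex.normSq_nonneg x.2
  have hx' : Complex.normSq x.1 + Complex.normSq x.2 ≤ R := hx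
  rw [mem_closedBall_zero_iff, Prod.norm_def, max_le_iff]
  rw [Complex.normSq_eq_norm_sq] at *
  rw [Complex.normSq_eq_norm_sq] at *
  constructor <;> nlinarith [sq_nonneg (‖x.1‖ - 1), sq_nonneg (‖x.2‖ - 1), norm_nonneg x.1,
    norm_nonneg x.2]

theorem isCompact_shell : IsCompact shell := by
  have : shell = {x | nsq x ≤ 4} ∩ {x | 1 ≤ nsq x} := by
    ext x; exact and_comm
  rw [this]
  exact (isCompact_nsq_le 4).inter_right (isClosed_le continuous_const continuous_nsq)

theorem nsq_dir {x : ℂ × ℂ} (hx : x ∈ shell) : nsq (dir x) = 1 := by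
  have h : 0 < nsq x := one_pos.trans_le hx.1
  rw [dir, nsq_smul, inv_pow, Real.sq_sqrt h.le, inv_mul_cancel₀ h.ne']

theorem continuousOn_dir : ContinuousOn dir shell := by
  unfold dir
  refine ContinuousOn.smul (ContinuousOn.inv₀
    (Real.continuous_sqrt.comp continuous_nsq).continuousOn fun x hx => ?_) continuousOn_id
  exact (Real.sqrt_pos.2 (one_pos.trans_le hx.1)).ne'

theorem smul_dir_mem {r : ℝ} (hr : r ∈ Ioo (-1 : ℝ) 1) {x : ℂ × ℂ} (hx : x ∈ shell) :
    r • dir x ∈ unitBall := by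
  have : r ^ 2 < 1 := by nlinarith [hr.1, hr.2]
  simpa [unitBall, nsq_smul, nsq_dir hx] using this

/-- The shell has positive finite volume. -/
theorem volume_shell_pos : 0 < volume shell := by
  refine lt_of_lt_of_le (IsOpen.measure_pos volume (U := {x : ℂ × ℂ | 1 < nsq x ∧ nsq x < 4}) ?_ ?_)
    (measure_mono fun x hx => ⟨hx.1.le, hx.2.le⟩)
  · exact (isOpen_lt continuous_const continuous_nsq).inter
      (isOpen_lt continuous_nsq continuous_const)
  · exact ⟨(1, 1), by norm_num [nsq]⟩

instance isAddHaarMeasure_volume : (volume : Measure (ℂ × ℂ)).IsAddHaarMeasure := by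
  rw [Measure.volume_eq_prod]
  infer_instance

theorem eq_zero_of_nsq_eq_zero {x : ℂ × ℂ} (h : nsq x = 0) : x = 0 := by
  have h1 := Complex.normSq_nonneg x.1
  have h2 := Complex.normSq_nonneg x.2
  have h' : Complex.normSq x.1 + Complex.normSq x.2 = 0 := h
  exact Prod.ext (Complex.normSq_eq_zero.1 (by linarith)) (Complex.normSq_eq_zero.1 (by linarith))

theorem injective_of_nsq (T : (ℂ × ℂ) →ₗ[ℝ] (ℂ × ℂ)) (hT : ∀ x, nsq (T x) = nsq x) :
    Function.Injective T := by
  rw [injective_iff_map_eq_zero]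
  intro x hx
  refine eq_zero_of_nsq_eq_zero ?_
  rw [← hT, hx, nsq_zero]

/-- A real linear map of `ℂ²` that preserves the Euclidean norm preserves Lebesgue measure: it maps
the shell, whose volume is positive and finite, onto itself, so its determinant is `±1`. -/
theorem measurePreserving_of_nsq (T : (ℂ × ℂ) →ₗ[ℝ] (ℂ × ℂ)) (hT : ∀ x, nsq (T x) = nsq x) :
    MeasurePreserving T volume volume := by
  have hinj := injective_of_nsq T hT
  have hsurj : Function.Surjective T := LinearMap.injective_iff_surjective.1 hinj
  have himg : T '' shell = shell := by
    ext y
    constructor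
    · rintro ⟨x, hx, rfl⟩
      simpa [shell, hT] using hx
    · intro hy
      obtain ⟨x, rfl⟩ := hsurj y
      exact ⟨x, by simpa [shell, hT] using hy, rfl⟩
  have hdet : ENNReal.ofReal |LinearMap.det T| = 1 := by
    have h := Measure.addHaar_image_linearMap volume T shell
    rw [himg] at h
    have h0 := volume_shell_pos.ne'
    have h1 : volume shell ≠ ⊤ := isCompact_shell.measure_lt_top.ne
    exact ((ENNReal.mul_eq_right h0 h1).1 h.symm)
  have hdet0 : LinearMap.det T ≠ 0 := by
    intro h
    simp [h] at hdet
  refine ⟨(LinearMap.continuous_of_finiteDimensional T).measurable, ?_⟩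
  rw [Measure.map_linearMap_addHaar_eq_smul_addHaar volume hdet0, abs_inv,
    ENNReal.ofReal_inv_of_pos (abs_pos.2 hdet0), hdet]
  simp

/-- Rotation invariance of integrals over sets described by the Euclidean norm. -/
theorem setIntegral_nsq_comp (T : (ℂ × ℂ) →ₗ[ℝ] (ℂ × ℂ)) (hT : ∀ x, nsq (T x) = nsq x)
    (P : Set ℝ) (g : ℂ × ℂ → ℂ) : ∫ x in nsq ⁻¹' P, g (T x) = ∫ x in nsq ⁻¹' P, g x := by
  have hemb : MeasurableEmbedding T := (LinearMap.isClosedEmbedding_of_injective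
    (LinearMap.ker_eq_bot.2 (injective_of_nsq T hT))).measurableEmbedding
  have := (measurePreserving_of_nsq T hT).setIntegral_preimage_emb hemb g (nsq ⁻¹' P)
  rwa [show T ⁻¹' (nsq ⁻¹' P) = nsq ⁻¹' P by ext x; simp [hT]] at this

theorem setIntegral_shell_comp (T : (ℂ × ℂ) →ₗ[ℝ] (ℂ × ℂ)) (hT : ∀ x, nsq (T x) = nsq x)
    (g : ℂ × ℂ → ℂ) : ∫ x in shell, g (T x) = ∫ x in shell, g x :=
  setIntegral_nsq_comp T hT (Icc 1 4) g

/-- Differentiation under the integral sign over a compact set. -/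
theorem hasDerivAt_setIntegral_of_continuousOn {S : Set (ℂ × ℂ)} (hS : IsCompact S) {I : Set ℝ}
    (hI : IsOpen I) {g g' : ℝ → ℂ × ℂ → ℂ}
    (hg : ContinuousOn (fun p : ℝ × ℂ × ℂ => g p.1 p.2) (I ×ˢ S))
    (hg' : ContinuousOn (fun p : ℝ × ℂ × ℂ => g' p.1 p.2) (I ×ˢ S))
    (hd : ∀ t ∈ I, ∀ x ∈ S, HasDerivAt (fun t => g t x) (g' t x) t) {t₀ : ℝ} (ht₀ : t₀ ∈ I) :
    HasDerivAt (fun t => ∫ x in S, g t x) (∫ x in S, g' t₀ x) t₀ := by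
  obtain ⟨ε, hε, hball⟩ := Metric.nhds_basis_closedBall.mem_iff.1 (hI.mem_nhds ht₀)
  obtain ⟨C, hC⟩ := ((isCompact_closedBall t₀ ε).prod hS).exists_bound_of_continuousOn
    (hg'.mono (prod_mono hball subset_rfl))
  have hslice : ∀ h : ℝ → ℂ × ℂ → ℂ, ContinuousOn (fun p : ℝ × ℂ × ℂ => h p.1 p.2) (I ×ˢ S) →
      ∀ t ∈ I, IntegrableOn (h t) S := fun h hh t ht =>
    ContinuousOn.integrableOn_compact hS
      (hh.comp (f := fun x => (t, x)) (by fun_prop) fun x hx => ⟨ht, hx⟩)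
  refine (hasDerivAt_integral_of_dominated_loc_of_deriv_le (bound := fun _ => C)
    (Metric.closedBall_mem_nhds t₀ hε) ?_ (hslice g hg t₀ ht₀) (hslice g' hg' t₀ ht₀).1 ?_ ?_ ?_).2
  · filter_upwards [hI.mem_nhds ht₀] with t ht using (hslice g hg t ht).1
  · filter_upwards [ae_restrict_mem hS.measurableSet] with x hx t ht using hC (t, x) ⟨ht, hx⟩
  · exact integrableOn_const hS.measure_lt_top.ne
  · filter_upwards [ae_restrict_mem hS.measurableSet] with x hx t ht using hd t (hball ht) x hx

/-! ### Spherical means and their differential equation -/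

section SphericalMeans

variable {F : ℂ × ℂ → ℂ} {U : Set (ℂ × ℂ)}

theorem contDiffOn_fderiv (hU : IsOpen U) (hF : ContDiffOn ℝ 2 F U) :
    ContDiffOn ℝ 1 (fderiv ℝ F) U := hF.fderiv_of_isOpen hU (by norm_num)

theorem hasFDerivAt_of_contDiffOn (hU : IsOpen U) (hF : ContDiffOn ℝ 2 F U) {p : ℂ × ℂ}
    (hp : p ∈ U) : HasFDerivAt F (fderiv ℝ F p) p :=
  ((hF.differentiableOn (by norm_num)).differentiableAt (hU.mem_nhds hp)).hasFDerivAt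

theorem hasFDerivAt_fderiv_of_contDiffOn (hU : IsOpen U) (hF : ContDiffOn ℝ 2 F U) {p : ℂ × ℂ}
    (hp : p ∈ U) : HasFDerivAt (fderiv ℝ F) (fderiv ℝ (fderiv ℝ F) p) p :=
  (((contDiffOn_fderiv hU hF).differentiableOn (by norm_num)).differentiableAt
    (hU.mem_nhds hp)).hasFDerivAt

theorem continuousOn_fderiv_fderiv (hU : IsOpen U) (hF : ContDiffOn ℝ 2 F U) :
    ContinuousOn (fderiv ℝ (fderiv ℝ F)) U :=
  (contDiffOn_fderiv hU hF).continuousOn_fderiv_of_isOpen hU le_rfl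

theorem hasDerivAt_comp_curve (hU : IsOpen U) (hF : ContDiffOn ℝ 2 F U) {γ : ℝ → ℂ × ℂ}
    {v : ℂ × ℂ} {t : ℝ} (hγ : HasDerivAt γ v t) (hp : γ t ∈ U) :
    HasDerivAt (fun t => F (γ t)) (fderiv ℝ F (γ t) v) t :=
  (hasFDerivAt_of_contDiffOn hU hF hp).comp_hasDerivAt t hγ

theorem hasDerivAt_fderiv_comp_curve (hU : IsOpen U) (hF : ContDiffOn ℝ 2 F U)
    {γ γ' : ℝ → ℂ × ℂ} {a : ℂ × ℂ} {t : ℝ} (hγ : HasDerivAt γ (γ' t) t) (hγ' : HasDerivAt γ' a t)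
    (hp : γ t ∈ U) :
    HasDerivAt (fun t => fderiv ℝ F (γ t) (γ' t))
      (fderiv ℝ (fderiv ℝ F) (γ t) (γ' t) (γ' t) + fderiv ℝ F (γ t) a) t :=
  ((hasFDerivAt_fderiv_of_contDiffOn hU hF hp).comp_hasDerivAt t hγ).clm_apply hγ'

/-- First and second derivative of the integral of `F` over a family of curves `t ↦ γ t x`. -/
theorem hasDerivAt_setIntegral_comp_curve (hU : IsOpen U) (hF : ContDiffOn ℝ 2 F U)
    {S : Set (ℂ × ℂ)} (hS : IsCompact S) {I : Set ℝ} (hI : IsOpen I)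
    {γ γ' γ'' : ℝ → ℂ × ℂ → ℂ × ℂ}
    (hc : ContinuousOn (fun p : ℝ × ℂ × ℂ => γ p.1 p.2) (I ×ˢ S))
    (hc' : ContinuousOn (fun p : ℝ × ℂ × ℂ => γ' p.1 p.2) (I ×ˢ S))
    (hc'' : ContinuousOn (fun p : ℝ × ℂ × ℂ => γ'' p.1 p.2) (I ×ˢ S))
    (hd : ∀ t ∈ I, ∀ x ∈ S, HasDerivAt (fun t => γ t x) (γ' t x) t)
    (hd' : ∀ t ∈ I, ∀ x ∈ S, HasDerivAt (fun t => γ' t x) (γ'' t x) t)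
    (hm : ∀ t ∈ I, ∀ x ∈ S, γ t x ∈ U) {t : ℝ} (ht : t ∈ I) :
    HasDerivAt (fun t => ∫ x in S, F (γ t x)) (∫ x in S, fderiv ℝ F (γ t x) (γ' t x)) t ∧
    HasDerivAt (fun t => ∫ x in S, fderiv ℝ F (γ t x) (γ' t x))
      (∫ x in S, (fderiv ℝ (fderiv ℝ F) (γ t x) (γ' t x) (γ' t x)
        + fderiv ℝ F (γ t x) (γ'' t x))) t := by
  have hmaps : MapsTo (fun p : ℝ × ℂ × ℂ => γ p.1 p.2) (I ×ˢ S) U := fun p hp =>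
    hm p.1 hp.1 p.2 hp.2
  have h0 := hF.continuousOn.comp hc hmaps
  have h1 := (contDiffOn_fderiv hU hF).continuousOn.comp hc hmaps
  have h2 := (continuousOn_fderiv_fderiv hU hF).comp hc hmaps
  exact ⟨hasDerivAt_setIntegral_of_continuousOn hS hI h0 (h1.clm_apply hc')
      (fun t ht x hx => hasDerivAt_comp_curve hU hF (hd t ht x hx) (hm t ht x hx)) ht,
    hasDerivAt_setIntegral_of_continuousOn hS hI (h1.clm_apply hc')
      (((h2.clm_apply hc').clm_apply hc').add (h1.clm_apply hc''))
      (fun t ht x hx => hasDerivAt_fderiv_comp_curve hU hF (hd t ht x hx) (hd' t ht x hx)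
        (hm t ht x hx)) ht⟩

/-- The unnormalised mean of `F` over the sphere of radius `r` about the origin. -/
noncomputable def sphereMean (F : ℂ × ℂ → ℂ) (r : ℝ) : ℂ := ∫ x in shell, F (r • dir x)

/-- The mean over the sphere of radius `r` of the radial derivative of `F`. -/
noncomputable def sphereMeanDeriv (F : ℂ × ℂ → ℂ) (r : ℝ) : ℂ :=
  ∫ x in shell, fderiv ℝ F (r • dir x) (dir x)

/-- The mean over the sphere of radius `r` of the second radial derivative of `F`. -/
noncomputable def sphereMeanDeriv₂ (F : ℂ × ℂ → ℂ) (r : ℝ) : ℂ :=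
  ∫ x in shell, fderiv ℝ (fderiv ℝ F) (r • dir x) (dir x) (dir x)

theorem hasDerivAt_sphereMean (hF : ContDiffOn ℝ 2 F unitBall) {r : ℝ}
    (hr : r ∈ Ioo (-1 : ℝ) 1) :
    HasDerivAt (sphereMean F) (sphereMeanDeriv F r) r ∧
      HasDerivAt (sphereMeanDeriv F) (sphereMeanDeriv₂ F r) r := by
  have hdir : ContinuousOn (fun p : ℝ × ℂ × ℂ => dir p.2) (Ioo (-1 : ℝ) 1 ×ˢ shell) :=
    continuousOn_dir.comp continuousOn_snd fun p hp => hp.2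
  have h := hasDerivAt_setIntegral_comp_curve (γ := fun r x => r • dir x) (γ' := fun _ x => dir x)
    (γ'' := fun _ _ => 0) isOpen_unitBall hF isCompact_shell isOpen_Ioo
    (continuousOn_fst.smul hdir) hdir continuousOn_const
    (fun t _ x _ => by simpa using (hasDerivAt_id t).smul_const (dir x))
    (fun t _ x _ => hasDerivAt_const t _) (fun t ht x hx => smul_dir_mem ht hx) hr
  simp only [map_zero, add_zero] at h
  exact h

/-- A linear complex structure on `ℂ² = ℝ⁴` whose exponentials `cos t + sin t J` are rotations. -/
structure IsRotationGenerator (J : (ℂ × ℂ) →ₗ[ℝ] (ℂ × ℂ)) : Prop where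
  sq : ∀ x, J (J x) = -x
  nsq_rot : ∀ (t : ℝ) (x : ℂ × ℂ), nsq (Real.cos t • x + Real.sin t • J x) = nsq x

theorem dir_map (T : (ℂ × ℂ) →ₗ[ℝ] (ℂ × ℂ)) (hT : ∀ x, nsq (T x) = nsq x) (x : ℂ × ℂ) :
    dir (T x) = T (dir x) := by
  simp [dir, hT]

/-- The mean of `F` over a sphere does not change along a one-parameter group of rotations; this
records that its first two derivatives in the parameter vanish. -/
theorem sphereMean_rotation (hF : ContDiffOn ℝ 2 F unitBall) {J : (ℂ × ℂ) →ₗ[ℝ] (ℂ × ℂ)}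
    (hJ : IsRotationGenerator J) {r : ℝ} (hr : r ∈ Ioo (-1 : ℝ) 1) :
    ∫ x in shell, fderiv ℝ F (r • dir x) (r • J (dir x)) = 0 ∧
    ∫ x in shell, (fderiv ℝ (fderiv ℝ F) (r • dir x) (r • J (dir x)) (r • J (dir x))
      + fderiv ℝ F (r • dir x) (-(r • dir x))) = 0 := by
  set γ : ℝ → ℂ × ℂ → ℂ × ℂ := fun t x => r • (Real.cos t • dir x + Real.sin t • J (dir x)) with hγ
  set γ' : ℝ → ℂ × ℂ → ℂ × ℂ :=
    fun t x => r • (-Real.sin t • dir x + Real.cos t • J (dir x)) with hγ'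
  set γ'' : ℝ → ℂ × ℂ → ℂ × ℂ :=
    fun t x => r • (-Real.cos t • dir x + -Real.sin t • J (dir x)) with hγ''
  let T : ℝ → (ℂ × ℂ) →ₗ[ℝ] (ℂ × ℂ) := fun t => Real.cos t • LinearMap.id + Real.sin t • J
  have hT : ∀ t x, T t x = Real.cos t • x + Real.sin t • J x := fun t x => by simp [T]
  have hTn : ∀ t x, nsq (T t x) = nsq x := fun t x => by rw [hT, hJ.nsq_rot]
  have hdir : ContinuousOn (fun p : ℝ × ℂ × ℂ => dir p.2) (univ ×ˢ shell) :=
    continuousOn_dir.comp continuousOn_snd fun p hp => hp.2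
  have hJdir : ContinuousOn (fun p : ℝ × ℂ × ℂ => J (dir p.2)) (univ ×ˢ shell) :=
    (LinearMap.continuous_of_finiteDimensional J).comp_continuousOn hdir
  have hcos : ContinuousOn (fun p : ℝ × ℂ × ℂ => Real.cos p.1) (univ ×ˢ shell) :=
    (Real.continuous_cos.comp continuous_fst).continuousOn
  have hsin : ContinuousOn (fun p : ℝ × ℂ × ℂ => Real.sin p.1) (univ ×ˢ shell) :=
    (Real.continuous_sin.comp continuous_fst).continuousOn
  have key := fun t : ℝ => hasDerivAt_setIntegral_comp_curve (γ := γ) (γ' := γ') (γ'' := γ'')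
    isOpen_unitBall hF isCompact_shell isOpen_univ
    (((hcos.smul hdir).add (hsin.smul hJdir)).const_smul r)
    (((hsin.neg.smul hdir).add (hcos.smul hJdir)).const_smul r)
    (((hcos.neg.smul hdir).add (hsin.neg.smul hJdir)).const_smul r)
    (fun t _ x _ => (((Real.hasDerivAt_cos t).smul_const (dir x)).add
      ((Real.hasDerivAt_sin t).smul_const (J (dir x)))).const_smul r)
    (fun t _ x _ => (((Real.hasDerivAt_sin t).neg.smul_const (dir x)).add
      ((Real.hasDerivAt_cos t).smul_const (J (dir x)))).const_smul r)
    (fun t _ x hx => by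
      have : r ^ 2 < 1 := by nlinarith [hr.1, hr.2]
      change nsq (r • (Real.cos t • dir x + Real.sin t • J (dir x))) < 1
      rwa [nsq_smul, hJ.nsq_rot, nsq_dir hx, mul_one]) (mem_univ t)
  have hconst : ∀ t, ∫ x in shell, F (γ t x) = ∫ x in shell, F (r • dir x) := fun t => by
    rw [← setIntegral_shell_comp (T t) (hTn t) fun x => F (r • dir x)]
    simp_rw [dir_map (T t) (hTn t), hT, hγ]
  have h1 : ∀ t, ∫ x in shell, fderiv ℝ F (γ t x) (γ' t x) = 0 := fun t => by
    have h := (key t).1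
    simp only [hconst] at h
    exact h.unique (hasDerivAt_const t _)
  have h2 := (key 0).2
  simp only [h1] at h2
  have h2' := h2.unique (hasDerivAt_const 0 _)
  exact ⟨by simpa [hγ, hγ'] using h1 0, by simpa [hγ, hγ', hγ''] using h2'⟩

theorem integrableOn_shell_of_continuousOn {g : ℂ × ℂ → ℂ} (hg : ContinuousOn g shell) :
    IntegrableOn g shell := hg.integrableOn_compact isCompact_shell

theorem continuousOn_smul_dir (r : ℝ) : ContinuousOn (fun x => r • dir x) shell :=
  continuousOn_dir.const_smul r

theorem continuousOn_fderiv_dir (hF : ContDiffOn ℝ 2 F unitBall) {r : ℝ}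
    (hr : r ∈ Ioo (-1 : ℝ) 1) {v : ℂ × ℂ → ℂ × ℂ} (hv : ContinuousOn v shell) :
    ContinuousOn (fun x => fderiv ℝ F (r • dir x) (v x)) shell :=
  ((contDiffOn_fderiv isOpen_unitBall hF).continuousOn.comp (continuousOn_smul_dir r)
    fun _ hx => smul_dir_mem hr hx).clm_apply hv

theorem continuousOn_fderiv_fderiv_dir (hF : ContDiffOn ℝ 2 F unitBall) {r : ℝ}
    (hr : r ∈ Ioo (-1 : ℝ) 1) {v : ℂ × ℂ → ℂ × ℂ} (hv : ContinuousOn v shell) :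
    ContinuousOn (fun x => fderiv ℝ (fderiv ℝ F) (r • dir x) (v x) (v x)) shell :=
  (((continuousOn_fderiv_fderiv isOpen_unitBall hF).comp (continuousOn_smul_dir r)
    fun _ hx => smul_dir_mem hr hx).clm_apply hv).clm_apply hv

/-- The mean of the second derivative of `F` in a direction tangent to the sphere and given by a
rotation is `1 / r` times the mean of the radial derivative. -/
theorem sphereMean_second_tangential (hF : ContDiffOn ℝ 2 F unitBall)
    {J : (ℂ × ℂ) →ₗ[ℝ] (ℂ × ℂ)} (hJ : IsRotationGenerator J) {r : ℝ} (hr : r ∈ Ioo (0 : ℝ) 1) :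
    r * ∫ x in shell, fderiv ℝ (fderiv ℝ F) (r • dir x) (J (dir x)) (J (dir x))
      = sphereMeanDeriv F r := by
  have hr' : r ∈ Ioo (-1 : ℝ) 1 := ⟨by linarith [hr.1], hr.2⟩
  have h := (sphereMean_rotation hF hJ hr').2
  have hJc : ContinuousOn (fun x => J (dir x)) shell :=
    (LinearMap.continuous_of_finiteDimensional J).comp_continuousOn continuousOn_dir
  simp only [map_smul, map_neg, smul_apply] at h
  rw [integral_add] at h
  · simp only [integral_smul, integral_neg] at h
    rw [sphereMeanDeriv]
    simp only [Complex.real_smul] at h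
    have hr0 : (r : ℂ) ≠ 0 := by exact_mod_cast hr.1.ne'
    apply mul_left_cancel₀ hr0
    linear_combination h
  · exact (((integrableOn_shell_of_continuousOn
      (continuousOn_fderiv_fderiv_dir hF hr' hJc)).smul r).smul r)
  · exact ((integrableOn_shell_of_continuousOn
      (continuousOn_fderiv_dir hF hr' continuousOn_dir)).smul r).neg

theorem sphereMean_first_tangential (hF : ContDiffOn ℝ 2 F unitBall)
    {J : (ℂ × ℂ) →ₗ[ℝ] (ℂ × ℂ)} (hJ : IsRotationGenerator J) {r : ℝ} (hr : r ∈ Ioo (0 : ℝ) 1) :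
    ∫ x in shell, fderiv ℝ F (r • dir x) (J (dir x)) = 0 := by
  have hr' : r ∈ Ioo (-1 : ℝ) 1 := ⟨by linarith [hr.1], hr.2⟩
  have h := (sphereMean_rotation hF hJ hr').1
  simp only [map_smul, integral_smul] at h
  rw [Complex.real_smul] at h
  have hr0 : (r : ℂ) ≠ 0 := by exact_mod_cast hr.1.ne'
  exact (mul_eq_zero.1 h).resolve_left hr0

/-- The vector `(-conj x₂, conj x₁)`, orthogonal to `x` for the Hermitian inner product. -/
noncomputable def perp : (ℂ × ℂ) →ₗ[ℝ] (ℂ × ℂ) where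
  toFun x := (-(starRingEnd ℂ) x.2, (starRingEnd ℂ) x.1)
  map_add' x y := by ext <;> simp [add_comm]
  map_smul' r x := by ext <;> simp

/-- Multiplication by `i` on `ℂ²`, as a real linear map. -/
noncomputable def mulI : (ℂ × ℂ) →ₗ[ℝ] (ℂ × ℂ) where
  toFun x := Complex.I • x
  map_add' := smul_add _
  map_smul' _ _ := smul_comm _ _ _

theorem perp_apply (x : ℂ × ℂ) : perp x = (-(starRingEnd ℂ) x.2, (starRingEnd ℂ) x.1) := rfl

theorem mulI_apply (x : ℂ × ℂ) : mulI x = Complex.I • x := rfl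

theorem isRotationGenerator_mulI : IsRotationGenerator mulI where
  sq x := by simp [mulI_apply, smul_smul]
  nsq_rot t x := by
    have h := Real.sin_sq_add_cos_sq t
    simp only [nsq, mulI_apply, Complex.normSq_apply, Prod.fst_add, Prod.smul_fst, Prod.snd_add,
      Prod.smul_snd, Complex.add_re, Complex.add_im, Complex.real_smul, Complex.mul_re,
      Complex.mul_im, Complex.ofReal_re, Complex.ofReal_im, smul_eq_mul, Complex.I_re, Complex.I_im]
    linear_combination (x.1.re * x.1.re + x.1.im * x.1.im + (x.2.re * x.2.re + x.2.im * x.2.im)) * h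

theorem isRotationGenerator_perp : IsRotationGenerator perp where
  sq x := by ext <;> simp [perp_apply]
  nsq_rot t x := by
    have h := Real.sin_sq_add_cos_sq t
    simp only [nsq, perp_apply, Complex.normSq_apply, Prod.fst_add, Prod.smul_fst, Prod.snd_add,
      Prod.smul_snd, Complex.add_re, Complex.add_im, Complex.real_smul, Complex.mul_re,
      Complex.mul_im, Complex.ofReal_re, Complex.ofReal_im, Complex.neg_re, Complex.neg_im,
      Complex.conj_re, Complex.conj_im]
    linear_combination (x.1.re * x.1.re + x.1.im * x.1.im + (x.2.re * x.2.re + x.2.im * x.2.im)) * h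

theorem isRotationGenerator_mulI_perp : IsRotationGenerator (mulI ∘ₗ perp) where
  sq x := by
    ext <;> simp [perp_apply, mulI_apply, Complex.ext_iff]
  nsq_rot t x := by
    have h := Real.sin_sq_add_cos_sq t
    simp only [nsq, perp_apply, mulI_apply, LinearMap.comp_apply, Complex.normSq_apply,
      Prod.fst_add, Prod.smul_fst, Prod.snd_add,
      Prod.smul_snd, Complex.add_re, Complex.add_im, Complex.real_smul, Complex.mul_re,
      Complex.mul_im, Complex.ofReal_re, Complex.ofReal_im, Complex.neg_re, Complex.neg_im,
      Complex.conj_re, Complex.conj_im, smul_eq_mul, Complex.I_re, Complex.I_im]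
    linear_combination (x.1.re * x.1.re + x.1.im * x.1.im + (x.2.re * x.2.re + x.2.im * x.2.im)) * h

/-- Four times the Levi form of `F` at `p` in the direction `v`: the Laplacian at `0` of
`s ↦ F (p + s v)` on the complex plane. -/
noncomputable def leviForm (F : ℂ × ℂ → ℂ) (p v : ℂ × ℂ) : ℂ :=
  fderiv ℝ (fderiv ℝ F) p v v + fderiv ℝ (fderiv ℝ F) p (Complex.I • v) (Complex.I • v)

/-- The weighted invariant Laplace equation on the unit ball, in polar form: `x` is the direction
and `r` the radius of the point `r • x`. -/
def BallEigenfunction (k : ℝ) (eigval : ℂ) (F : ℂ × ℂ → ℂ) : Prop :=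
  ∀ r ∈ Ioo (0 : ℝ) 1, ∀ x : ℂ × ℂ, nsq x = 1 →
    (1 - (r : ℂ) ^ 2) * ((1 - (r : ℂ) ^ 2) * leviForm F (r • x) x + leviForm F (r • x) (perp x)
      - 4 * Complex.I * k * fderiv ℝ F (r • x) (Complex.I • (r • x)) + 4 * (k : ℂ) ^ 2 * F (r • x))
      = 4 * eigval * F (r • x)

/-- Averaging the Laplace equation over spheres gives an ordinary differential equation for the
spherical mean. The first-order angular term drops out. -/
theorem sphereMean_ode (hF : ContDiffOn ℝ 2 F unitBall) {k : ℝ} {eigval : ℂ}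
    (h : BallEigenfunction k eigval F) {r : ℝ} (hr : r ∈ Ioo (0 : ℝ) 1) :
    (1 - (r : ℂ) ^ 2) * ((1 - (r : ℂ) ^ 2) * (sphereMeanDeriv₂ F r + sphereMeanDeriv F r / r)
      + 2 * sphereMeanDeriv F r / r + 4 * (k : ℂ) ^ 2 * sphereMean F r)
      = 4 * eigval * sphereMean F r := by
  have hr' : r ∈ Ioo (-1 : ℝ) 1 := ⟨by linarith [hr.1], hr.2⟩
  have hr0 : (r : ℂ) ≠ 0 := by exact_mod_cast hr.1.ne'
  have hc : ∀ J : (ℂ × ℂ) →ₗ[ℝ] (ℂ × ℂ), ContinuousOn (fun x => J (dir x)) shell := fun J =>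
    (LinearMap.continuous_of_finiteDimensional J).comp_continuousOn continuousOn_dir
  have i0 : IntegrableOn (fun x => F (r • dir x)) shell :=
    integrableOn_shell_of_continuousOn
      (hF.continuousOn.comp (continuousOn_smul_dir r) fun _ hx => smul_dir_mem hr' hx)
  have i1 := integrableOn_shell_of_continuousOn (continuousOn_fderiv_dir hF hr' (hc mulI))
  have j0 := integrableOn_shell_of_continuousOn
    (continuousOn_fderiv_fderiv_dir hF hr' continuousOn_dir)
  have j := fun J => integrableOn_shell_of_continuousOn
    (continuousOn_fderiv_fderiv_dir hF hr' (hc J))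
  have e1 := sphereMean_first_tangential hF isRotationGenerator_mulI hr
  have e := fun {J} hJ => sphereMean_second_tangential (J := J) hF hJ hr
  have e2 := e isRotationGenerator_mulI
  have e3 := e isRotationGenerator_perp
  have e4 := e isRotationGenerator_mulI_perp
  have hint : ∫ x in shell, ((1 - (r : ℂ) ^ 2) * ((1 - (r : ℂ) ^ 2) *
      (fderiv ℝ (fderiv ℝ F) (r • dir x) (dir x) (dir x)
        + fderiv ℝ (fderiv ℝ F) (r • dir x) (mulI (dir x)) (mulI (dir x)))
      + (fderiv ℝ (fderiv ℝ F) (r • dir x) (perp (dir x)) (perp (dir x))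
        + fderiv ℝ (fderiv ℝ F) (r • dir x) ((mulI ∘ₗ perp) (dir x)) ((mulI ∘ₗ perp) (dir x)))
      - 4 * Complex.I * k * r * fderiv ℝ F (r • dir x) (mulI (dir x))
      + 4 * (k : ℂ) ^ 2 * F (r • dir x)))
      = ∫ x in shell, 4 * eigval * F (r • dir x) := by
    refine setIntegral_congr_fun isCompact_shell.measurableSet fun x hx => ?_
    have := h r hr (dir x) (nsq_dir hx)
    simp only [leviForm] at this
    rw [smul_comm Complex.I r (dir x), (fderiv ℝ F (r • dir x)).map_smul, Complex.real_smul] at this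
    simp only [mulI_apply, LinearMap.comp_apply]
    linear_combination this
  rw [integral_const_mul, integral_const_mul, integral_add, integral_sub, integral_add,
    integral_const_mul, integral_const_mul, integral_const_mul, integral_add j0 (j _),
    integral_add (j _) (j _), e1] at hint
  · rw [sphereMean, ← hint, sphereMeanDeriv₂]
    have e2' : ∫ x in shell, fderiv ℝ (fderiv ℝ F) (r • dir x) (mulI (dir x)) (mulI (dir x))
      = sphereMeanDeriv F r / r := by rw [← e2]; field_simp
    have e3' : ∫ x in shell, fderiv ℝ (fderiv ℝ F) (r • dir x) (perp (dir x)) (perp (dir x))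
      = sphereMeanDeriv F r / r := by rw [← e3]; field_simp
    have e4' : ∫ x in shell, fderiv ℝ (fderiv ℝ F) (r • dir x) ((mulI ∘ₗ perp) (dir x))
        ((mulI ∘ₗ perp) (dir x)) = sphereMeanDeriv F r / r := by rw [← e4]; field_simp
    rw [e2', e3', e4']
    ring
  · exact (j0.add (j _)).const_mul _
  · exact (j _).add (j _)
  · exact ((j0.add (j _)).const_mul _).add ((j _).add (j _))
  · exact i1.const_mul _
  · exact (((j0.add (j _)).const_mul _).add ((j _).add (j _))).sub (i1.const_mul _)
  · exact i0.const_mul _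

end SphericalMeans

/-! ### Uniqueness for the radial equation and radial averaging -/

/-- A solution of `y'' = -a y' + q y` with `a ≥ 0` and bounded `q` that vanishes to first order at
`0` is zero. The coefficient `a` may blow up at `0`: by its sign it only decreases the energy
`|y|² + |y'|²`. -/
theorem eq_zero_of_damped_ode {y y₁ y₂ : ℝ → ℂ} {a : ℝ → ℝ} {q : ℝ → ℂ} {R Q : ℝ}
    (hy : ∀ r ∈ Icc 0 R, HasDerivAt y (y₁ r) r) (hy₁ : ∀ r ∈ Icc 0 R, HasDerivAt y₁ (y₂ r) r)
    (h0 : y 0 = 0) (h1 : y₁ 0 = 0) (ha : ∀ r ∈ Ioo 0 R, 0 ≤ a r) (hq : ∀ r ∈ Ioo 0 R, ‖q r‖ ≤ Q)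
    (hode : ∀ r ∈ Ioo 0 R, y₂ r = -(a r) * y₁ r + q r * y r) :
    ∀ r ∈ Icc 0 R, y r = 0 := by
  set G : ℝ → ℝ := fun r => Real.exp (-(1 + Q) * r) * (‖y r‖ ^ 2 + ‖y₁ r‖ ^ 2) with hG
  have hd : ∀ r ∈ Icc 0 R, HasDerivAt G (Real.exp (-(1 + Q) * r) * (-(1 + Q))
      * (‖y r‖ ^ 2 + ‖y₁ r‖ ^ 2)
      + Real.exp (-(1 + Q) * r) * (2 * inner ℝ (y r) (y₁ r) + 2 * inner ℝ (y₁ r) (y₂ r))) r := by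
    intro r hr
    have he : HasDerivAt (fun r : ℝ => Real.exp (-(1 + Q) * r))
        (Real.exp (-(1 + Q) * r) * (-(1 + Q))) r := by
      simpa using ((hasDerivAt_id r).const_mul (-(1 + Q))).exp
    exact he.mul ((hy r hr).norm_sq.add (hy₁ r hr).norm_sq)
  have hanti : AntitoneOn G (Icc 0 R) := by
    refine antitoneOn_of_deriv_nonpos (convex_Icc 0 R)
      (fun r hr => (hd r hr).continuousAt.continuousWithinAt)
      (fun r hr => (hd r (interior_subset hr)).differentiableAt.differentiableWithinAt) ?_
    intro r hr
    rw [interior_Icc] at hr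
    rw [(hd r (Ioo_subset_Icc_self hr)).deriv]
    have i1 : inner ℝ (y r) (y₁ r) ≤ ‖y r‖ * ‖y₁ r‖ := real_inner_le_norm _ _
    have i2 : inner ℝ (y₁ r) (y₂ r) ≤ Q * (‖y r‖ * ‖y₁ r‖) := by
      have e : y₂ r = (-(a r)) • y₁ r + q r * y r := by
        rw [hode r hr, Complex.real_smul]; push_cast; ring
      rw [e, inner_add_right, inner_smul_right, real_inner_self_eq_norm_sq]
      have i3 : inner ℝ (y₁ r) (q r * y r) ≤ ‖y₁ r‖ * (‖q r‖ * ‖y r‖) := by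
        rw [← norm_mul]; exact real_inner_le_norm _ _
      have i4 : ‖q r‖ * (‖y r‖ * ‖y₁ r‖) ≤ Q * (‖y r‖ * ‖y₁ r‖) :=
        mul_le_mul_of_nonneg_right (hq r hr) (by positivity)
      nlinarith [mul_nonneg (ha r hr) (sq_nonneg ‖y₁ r‖)]
    have hQ : 0 ≤ Q := (norm_nonneg _).trans (hq r hr)
    have i5 : 2 * inner ℝ (y r) (y₁ r) + 2 * inner ℝ (y₁ r) (y₂ r)
        ≤ (1 + Q) * (‖y r‖ ^ 2 + ‖y₁ r‖ ^ 2) := by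
      nlinarith [mul_nonneg (by linarith : 0 ≤ 1 + Q) (sq_nonneg (‖y r‖ - ‖y₁ r‖))]
    have hexp := (Real.exp_pos (-(1 + Q) * r)).le
    nlinarith [mul_le_mul_of_nonneg_left i5 hexp]
  intro r hr
  have hle : Real.exp (-(1 + Q) * r) * (‖y r‖ ^ 2 + ‖y₁ r‖ ^ 2) ≤ 0 :=
    (hanti (left_mem_Icc.2 (hr.1.trans hr.2)) hr hr.1).trans_eq (by simp [hG, h0, h1])
  have : ‖y r‖ ^ 2 + ‖y₁ r‖ ^ 2 ≤ 0 :=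
    le_of_mul_le_mul_left (by simpa using hle) (Real.exp_pos (-(1 + Q) * r))
  have h2 : ‖y r‖ ^ 2 = 0 := by nlinarith [sq_nonneg ‖y r‖, sq_nonneg ‖y₁ r‖]
  simpa using h2

section RadialAveraging

variable {F : ℂ × ℂ → ℂ}

/-- The antipodal map preserves the mean and reverses the radial derivative at the centre. -/
theorem sphereMeanDeriv_zero (F : ℂ × ℂ → ℂ) : sphereMeanDeriv F 0 = 0 := by
  have h := setIntegral_shell_comp (-LinearMap.id) (fun x => by
    have := nsq_smul (-1) x
    simpa using this) (fun x => fderiv ℝ F ((0 : ℝ) • dir x) (dir x))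
  have hdir : ∀ x, dir (-x) = -dir x := fun x => by
    have := nsq_smul (-1) x
    simp only [dir, smul_neg]
    rw [show nsq (-x) = nsq x by simpa using this]
  simp only [LinearMap.neg_apply, LinearMap.id_apply, hdir, zero_smul, map_neg, integral_neg] at h
  have h' : -sphereMeanDeriv F 0 = sphereMeanDeriv F 0 := by
    simpa [sphereMeanDeriv] using h
  exact self_eq_neg.1 h'.symm

/-- The spherical means of an eigenfunction that vanishes at the centre are zero. -/
theorem sphereMean_eq_zero (hF : ContDiffOn ℝ 2 F unitBall) {k : ℝ} {eigval : ℂ}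
    (h : BallEigenfunction k eigval F) (h0 : F 0 = 0) {r : ℝ} (hr : r ∈ Ico (0 : ℝ) 1) :
    sphereMean F r = 0 := by
  have hsub : ∀ s ∈ Icc 0 r, s ∈ Ioo (-1 : ℝ) 1 := fun s hs =>
    ⟨by linarith [hs.1], hs.2.trans_lt hr.2⟩
  have hr1 : 0 < 1 - r ^ 2 := by nlinarith [hr.1, hr.2]
  -- `sphereMean_ode` solved for the second derivative.
  refine eq_zero_of_damped_ode (y := sphereMean F) (y₁ := sphereMeanDeriv F)
    (y₂ := sphereMeanDeriv₂ F) (a := fun s => 1 / s + 2 / (s * (1 - s ^ 2)))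
    (q := fun s => (4 * eigval / (1 - (s : ℂ) ^ 2) - 4 * (k : ℂ) ^ 2) / (1 - (s : ℂ) ^ 2))
    (Q := (4 * ‖eigval‖ / (1 - r ^ 2) + 4 * k ^ 2) / (1 - r ^ 2))
    (fun s hs => (hasDerivAt_sphereMean hF (hsub s hs)).1)
    (fun s hs => (hasDerivAt_sphereMean hF (hsub s hs)).2)
    (by simp [sphereMean, h0]) (sphereMeanDeriv_zero F) ?_ ?_ ?_ r (right_mem_Icc.2 hr.1)
  · intro s hs
    have hs1 : 0 < 1 - s ^ 2 := by nlinarith [hs.1, hs.2]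
    have := hs.1
    positivity
  · intro s hs
    have hs1 : 1 - r ^ 2 ≤ 1 - s ^ 2 := by nlinarith [hs.1, hs.2]
    have hn : ‖(1 - (s : ℂ) ^ 2)‖ = 1 - s ^ 2 := by
      rw [← Complex.ofReal_pow, ← Complex.ofReal_one, ← Complex.ofReal_sub, Complex.norm_real,
        Real.norm_eq_abs, abs_of_pos (hr1.trans_le hs1)]
    rw [norm_div, hn]
    refine div_le_div₀ (by positivity) ((norm_sub_le _ _).trans (add_le_add ?_ ?_)) hr1 hs1
    · rw [norm_div, hn, norm_mul]
      refine div_le_div₀ (by positivity) (by simp) hr1 hs1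
    · simp
  · intro s hs
    have hs' : s ∈ Ioo (0 : ℝ) 1 := ⟨hs.1, hs.2.trans hr.2⟩
    have hode := sphereMean_ode hF h hs'
    have hs0 : (s : ℂ) ≠ 0 := by exact_mod_cast hs'.1.ne'
    have hs1 : (1 - (s : ℂ) ^ 2) ≠ 0 := by
      have : (1 - s ^ 2 : ℝ) ≠ 0 := by nlinarith [hs'.1, hs'.2]
      exact_mod_cast this
    push_cast
    field_simp at hode ⊢
    linear_combination hode

/-- The product of `x` and `ζ` as quaternions `x₁ + x₂ j`, up to the choice of conventions: for unit
`x` this is the action on `ζ` of the matrix in `SU(2)` with first column `x`. -/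
noncomputable def qmul (x ζ : ℂ × ℂ) : ℂ × ℂ :=
  (x.1 * ζ.1 - (starRingEnd ℂ) x.2 * ζ.2, x.2 * ζ.1 + (starRingEnd ℂ) x.1 * ζ.2)

theorem nsq_qmul (x ζ : ℂ × ℂ) : nsq (qmul x ζ) = nsq x * nsq ζ := by
  simp [nsq, qmul, Complex.normSq_apply]; ring

/-- `qmul` as a real linear map in its second argument. -/
noncomputable def qmulLeft (x : ℂ × ℂ) : (ℂ × ℂ) →ₗ[ℝ] (ℂ × ℂ) where
  toFun ζ := qmul x ζ
  map_add' a b := by ext1 <;> simp [qmul] <;> ring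
  map_smul' r a := by ext1 <;> simp [qmul] <;> ring

/-- `qmul` as a real linear map in its first argument. -/
noncomputable def qmulRight (ζ : ℂ × ℂ) : (ℂ × ℂ) →ₗ[ℝ] (ℂ × ℂ) where
  toFun x := qmul x ζ
  map_add' a b := by ext1 <;> simp [qmul] <;> ring
  map_smul' r a := by ext1 <;> simp [qmul] <;> ring

/-- The mean of `F` over the rotated points `x̂ · ζ` is its spherical mean at radius `|ζ|`. -/
theorem setIntegral_qmul_dir (F : ℂ × ℂ → ℂ) (ζ : ℂ × ℂ) :
    ∫ x in shell, F (qmul (dir x) ζ) = sphereMean F (√(nsq ζ)) := by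
  obtain ⟨η, hη, hζ⟩ : ∃ η, nsq η = 1 ∧ ζ = √(nsq ζ) • η := by
    rcases (nsq_nonneg ζ).eq_or_lt with h | h
    · refine ⟨(1, 0), by simp [nsq], ?_⟩
      rw [← h, Real.sqrt_zero, zero_smul, eq_zero_of_nsq_eq_zero h.symm]
    · have h' := (Real.sqrt_pos.2 h).ne'
      refine ⟨(√(nsq ζ))⁻¹ • ζ, ?_, by rw [smul_smul, mul_inv_cancel₀ h', one_smul]⟩
      rw [nsq_smul, inv_pow, Real.sq_sqrt h.le, inv_mul_cancel₀ h.ne']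
  have hT : ∀ x, nsq (qmulRight η x) = nsq x := fun x => by
    change nsq (qmul x η) = _
    rw [nsq_qmul, hη, mul_one]
  rw [sphereMean, ← setIntegral_shell_comp (qmulRight η) hT fun x => F (√(nsq ζ) • dir x)]
  refine integral_congr_ae (Eventually.of_forall fun x => ?_)
  change F _ = F _
  rw [dir_map _ hT]
  congr 1
  conv_lhs => rw [hζ]
  exact (qmulLeft (dir x)).map_smul (√(nsq ζ)) η

theorem continuousOn_radial_mul_qmul (hF : ContinuousOn F unitBall) {R : ℝ} (hR : R < 1)
    {w : ℝ → ℂ} (hw : ContinuousOn w (Icc 0 R)) :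
    ContinuousOn (fun p : (ℂ × ℂ) × (ℂ × ℂ) => w (nsq p.2) * F (qmul (dir p.1) p.2))
      (shell ×ˢ (nsq ⁻¹' Iic R)) := by
  have h1 : ContinuousOn (fun p : (ℂ × ℂ) × (ℂ × ℂ) => w (nsq p.2)) (shell ×ˢ (nsq ⁻¹' Iic R)) :=
    hw.comp (f := fun p : (ℂ × ℂ) × (ℂ × ℂ) => nsq p.2)
      (continuous_nsq.comp continuous_snd).continuousOn fun _ hp => ⟨nsq_nonneg _, hp.2⟩
  have h2 : ContinuousOn (fun p : (ℂ × ℂ) × (ℂ × ℂ) => dir p.1) (shell ×ˢ (nsq ⁻¹' Iic R)) :=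
    continuousOn_dir.comp continuousOn_fst fun _ hp => hp.1
  have hconj := Complex.continuous_conj
  have h3 : ContinuousOn (fun p : (ℂ × ℂ) × (ℂ × ℂ) => qmul (dir p.1) p.2)
      (shell ×ˢ (nsq ⁻¹' Iic R)) :=
    ((h2.fst.mul continuousOn_snd.fst).sub
      ((hconj.comp_continuousOn h2.snd).mul continuousOn_snd.snd)).prodMk
      ((h2.snd.mul continuousOn_snd.fst).add
      ((hconj.comp_continuousOn h2.fst).mul continuousOn_snd.snd))
  have h4 : MapsTo (fun p : (ℂ × ℂ) × (ℂ × ℂ) => qmul (dir p.1) p.2)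
      (shell ×ˢ (nsq ⁻¹' Iic R)) unitBall := by
    rintro ⟨x, ζ⟩ ⟨hx, hζ⟩
    have e : nsq (qmul (dir x) ζ) = nsq ζ := by rw [nsq_qmul, nsq_dir hx, one_mul]
    exact e.trans_lt (lt_of_le_of_lt hζ hR)
  exact h1.mul (hF.comp h3 h4)

/-- A function whose spherical means vanish has vanishing integral against radial weights. -/
theorem setIntegral_radial_mul_eq_zero (hF : ContinuousOn F unitBall)
    (hM : ∀ r ∈ Ico (0 : ℝ) 1, sphereMean F r = 0) {R : ℝ} (hR : R < 1) {w : ℝ → ℂ}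
    (hw : ContinuousOn w (Icc 0 R)) : ∫ ζ in nsq ⁻¹' Iic R, w (nsq ζ) * F ζ = 0 := by
  have hK : IsCompact (nsq ⁻¹' Iic R) := isCompact_nsq_le R
  have hrot : ∀ x ∈ shell, ∫ ζ in nsq ⁻¹' Iic R, w (nsq ζ) * F (qmul (dir x) ζ)
      = ∫ ζ in nsq ⁻¹' Iic R, w (nsq ζ) * F ζ := fun x hx => by
    have hT : ∀ ζ, nsq (qmulLeft (dir x) ζ) = nsq ζ := fun ζ => by
      change nsq (qmul (dir x) ζ) = _
      rw [nsq_qmul, nsq_dir hx, one_mul]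
    have := setIntegral_nsq_comp (qmulLeft (dir x)) hT (Iic R) fun ζ => w (nsq ζ) * F ζ
    simp only [hT] at this
    exact this
  have hswap : ∫ x in shell, ∫ ζ in nsq ⁻¹' Iic R, w (nsq ζ) * F (qmul (dir x) ζ)
      = ∫ ζ in nsq ⁻¹' Iic R, ∫ x in shell, w (nsq ζ) * F (qmul (dir x) ζ) := by
    have hint := (continuousOn_radial_mul_qmul hF hR hw).integrableOn_compact
      (μ := volume.prod volume) (isCompact_shell.prod hK)
    rw [IntegrableOn, ← Measure.prod_restrict] at hint
    exact integral_integral_swap hint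
  have hzero : ∫ ζ in nsq ⁻¹' Iic R, ∫ x in shell, w (nsq ζ) * F (qmul (dir x) ζ) = 0 := by
    rw [setIntegral_congr_fun (g := fun _ => (0 : ℂ)) hK.measurableSet]
    · simp
    · intro ζ hζ
      have h1 : nsq ζ < 1 := lt_of_le_of_lt hζ hR
      change ∫ x in shell, w (nsq ζ) * F (qmul (dir x) ζ) = 0
      rw [integral_const_mul, setIntegral_qmul_dir, hM, mul_zero]
      exact ⟨Real.sqrt_nonneg _, by rw [Real.sqrt_lt' one_pos]; simpa using h1⟩
  rw [hzero, setIntegral_congr_fun isCompact_shell.measurableSet hrot, setIntegral_const,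
    smul_eq_zero] at hswap
  refine hswap.resolve_left ?_
  exact (ENNReal.toReal_pos volume_shell_pos.ne' isCompact_shell.measure_lt_top.ne).ne'

end RadialAveraging

/-! ### Algebraic identities and Wirtinger derivatives -/

/-- For `|x|² + |y|² = 1` and `x', y'` the complex conjugates of `x, y`, this and the following five
identities compare the coefficients of the invariant Laplacian of the ball at the point `r (x, y)` with
those of the Laplacian of the Siegel domain at its image under `cayley`. Here `s ^ 2` stands for `ρ(Z)`
and `b` for the second coordinate of `Z`. The indices name the derivatives that the coefficients
belong to; this one is for `∂²/∂w₂∂w̄₂`. -/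
theorem identity_22 {x y x' y' r s : ℂ} (h : x * x' + y * y' = 1) (hq : 1 + r * x ≠ 0)
    (hq' : 1 + r * x' ≠ 0) :
    (1 - r ^ 2) * ((1 - r ^ 2) * (s * y / (1 + r * x) ^ 2) * (s * y' / (1 + r * x') ^ 2)
      + (s * (x' + r) / (1 + r * x) ^ 2) * (s * (x + r) / (1 + r * x') ^ 2))
      = s ^ 2 * (1 - r ^ 2) / ((1 + r * x) * (1 + r * x')) := by
  field_simp
  grind

theorem identity_21 {x y x' y' r s b : ℂ} (h : x * x' + y * y' = 1) (hq : 1 + r * x ≠ 0)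
    (hq' : 1 + r * x' ≠ 0) :
    (1 - r ^ 2) * ((1 - r ^ 2) * (s * y / (1 + r * x) ^ 2)
        * ((-s ^ 2 * x' + b * s * y') / (1 + r * x') ^ 2)
      + (s * (x' + r) / (1 + r * x) ^ 2) * ((s ^ 2 * y + b * s * (x + r)) / (1 + r * x') ^ 2))
      = s ^ 2 * (1 - r ^ 2) / ((1 + r * x) * (1 + r * x')) * (b + s * (r * y) / (1 + r * x)) := by
  field_simp
  grind

theorem identity_11 {x y x' y' r s b b' : ℂ} (h : x * x' + y * y' = 1) (hq : 1 + r * x ≠ 0)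
    (hq' : 1 + r * x' ≠ 0) :
    (1 - r ^ 2) * ((1 - r ^ 2) * ((-s ^ 2 * x + b' * s * y) / (1 + r * x) ^ 2)
        * ((-s ^ 2 * x' + b * s * y') / (1 + r * x') ^ 2)
      + ((s ^ 2 * y' + b' * s * (x' + r)) / (1 + r * x) ^ 2)
        * ((s ^ 2 * y + b * s * (x + r)) / (1 + r * x') ^ 2))
      = s ^ 2 * (1 - r ^ 2) / ((1 + r * x) * (1 + r * x'))
        * (s ^ 2 / (1 + r * x) + s ^ 2 / (1 + r * x') - (s ^ 2 + b * b')
          + b' * (b + s * (r * y) / (1 + r * x)) + b * (b' + s * (r * y') / (1 + r * x'))) := by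
  field_simp
  grind

theorem identity_1 {x y x' y' r s b' : ℂ} (h : x * x' + y * y' = 1) (hq : 1 + r * x ≠ 0)
    (hq' : 1 + r * x' ≠ 0) :
    (1 - r ^ 2) * ((1 - r ^ 2) * (x' / (1 + r * x')) * ((-s ^ 2 * x + b' * s * y) / (1 + r * x) ^ 2)
      + (-y / (1 + r * x')) * ((s ^ 2 * y' + b' * s * (x' + r)) / (1 + r * x) ^ 2)
      + r * ((-s ^ 2 * x + b' * s * y) / (1 + r * x) ^ 2))
      = -(s ^ 2 * (1 - r ^ 2) / ((1 + r * x) * (1 + r * x'))) := by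
  field_simp
  grind

theorem identity_2 {x y x' r s : ℂ} (hq : 1 + r * x ≠ 0)
    (hq' : 1 + r * x' ≠ 0) :
    (1 - r ^ 2) * (x' / (1 + r * x')) * (s * y / (1 + r * x) ^ 2)
      + (-y / (1 + r * x')) * (s * (x' + r) / (1 + r * x) ^ 2)
      + r * (s * y / (1 + r * x) ^ 2) = 0 := by
  field_simp
  grind

theorem identity_0 {x y x' y' r : ℂ} (h : x * x' + y * y' = 1) (hq : 1 + r * x ≠ 0)
    (hq' : 1 + r * x' ≠ 0) :
    1 - (1 - r ^ 2) * (x / (1 + r * x)) * (x' / (1 + r * x'))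
      - (-y' / (1 + r * x)) * (-y / (1 + r * x')) - r * (x' / (1 + r * x') + x / (1 + r * x)) = 0 := by
  field_simp
  grind

section Wirtinger

variable {f : ℂ × ℂ → ℂ} {U : Set (ℂ × ℂ)}

theorem fderiv_wirtinger (hU : IsOpen U) (hf : ContDiffOn ℝ 2 f U) {p : ℂ × ℂ} (hp : p ∈ U)
    (v w : ℂ × ℂ) : fderiv ℝ (wirtinger v f) p w
      = (fderiv ℝ (fderiv ℝ f) p w v - Complex.I * fderiv ℝ (fderiv ℝ f) p w (Complex.I • v)) / 2 := by
  have h := hasFDerivAt_fderiv_of_contDiffOn hU hf hp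
  have h1 := h.clm_apply (hasFDerivAt_const v p)
  have h2 := h.clm_apply (hasFDerivAt_const (Complex.I • v) p)
  have h3 := (h1.sub (h2.const_mul Complex.I)).mul_const (2⁻¹ : ℂ)
  have e : wirtinger v f = fun Z =>
      (fderiv ℝ f Z v - Complex.I * fderiv ℝ f Z (Complex.I • v)) * 2⁻¹ := by
    funext Z; rw [wirtinger, div_eq_mul_inv]
  rw [e]
  erw [h3.fderiv]
  simp
  ring

theorem fderiv_wirtingerBar (hU : IsOpen U) (hf : ContDiffOn ℝ 2 f U) {p : ℂ × ℂ} (hp : p ∈ U)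
    (v w : ℂ × ℂ) : fderiv ℝ (wirtingerBar v f) p w
      = (fderiv ℝ (fderiv ℝ f) p w v + Complex.I * fderiv ℝ (fderiv ℝ f) p w (Complex.I • v)) / 2 := by
  have h := hasFDerivAt_fderiv_of_contDiffOn hU hf hp
  have h1 := h.clm_apply (hasFDerivAt_const v p)
  have h2 := h.clm_apply (hasFDerivAt_const (Complex.I • v) p)
  have h3 := (h1.add (h2.const_mul Complex.I)).mul_const (2⁻¹ : ℂ)
  have e : wirtingerBar v f = fun Z =>
      (fderiv ℝ f Z v + Complex.I * fderiv ℝ f Z (Complex.I • v)) * 2⁻¹ := by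
    funext Z; rw [wirtingerBar, div_eq_mul_inv]
  rw [e]
  erw [h3.fderiv]
  simp
  ring

theorem eq_real_combination (w : ℂ × ℂ) : w = w.1.re • ((1 : ℂ), (0 : ℂ))
    + w.1.im • (Complex.I • ((1 : ℂ), (0 : ℂ))) + w.2.re • ((0 : ℂ), (1 : ℂ))
    + w.2.im • (Complex.I • ((0 : ℂ), (1 : ℂ))) := by
  ext <;> simp

theorem I_smul_eq_real_combination (w : ℂ × ℂ) : Complex.I • w = (-w.1.im) • ((1 : ℂ), (0 : ℂ))
    + w.1.re • (Complex.I • ((1 : ℂ), (0 : ℂ))) + (-w.2.im) • ((0 : ℂ), (1 : ℂ))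
    + w.2.re • (Complex.I • ((0 : ℂ), (1 : ℂ))) := by
  ext1 <;> simp [Complex.ext_iff]

theorem fderiv_eq_wirtinger (f : ℂ × ℂ → ℂ) (p w : ℂ × ℂ) : fderiv ℝ f p w
    = w.1 * dz₁ f p + conj w.1 * dzbar₁ f p + w.2 * dz₂ f p + conj w.2 * dzbar₂ f p := by
  conv_lhs => rw [eq_real_combination w]
  simp only [map_add, (fderiv ℝ f p).map_smul, Complex.real_smul, dz₁, dzbar₁, dz₂, dzbar₂,
    wirtinger, wirtingerBar]
  obtain ⟨⟨a, b⟩, ⟨c, d⟩⟩ := w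
  have e1 : (⟨a, b⟩ : ℂ) = a + b * Complex.I := Complex.mk_eq_add_mul_I a b
  have e2 : (⟨c, d⟩ : ℂ) = c + d * Complex.I := Complex.mk_eq_add_mul_I c d
  simp only [e1, e2, map_add, map_mul, Complex.conj_I, Complex.conj_ofReal]
  simp
  ring_nf
  simp only [Complex.I_sq]
  ring

theorem fderiv_fderiv_symm (hU : IsOpen U) (hf : ContDiffOn ℝ 2 f U) {p : ℂ × ℂ} (hp : p ∈ U)
    (v w : ℂ × ℂ) : fderiv ℝ (fderiv ℝ f) p v w = fderiv ℝ (fderiv ℝ f) p w v :=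
  ((hf.contDiffAt (hU.mem_nhds hp)).isSymmSndFDerivAt (by simp)) v w

/-- The Levi form in terms of Wirtinger derivatives. -/
theorem leviForm_eq_wirtinger (hU : IsOpen U) (hf : ContDiffOn ℝ 2 f U) {p : ℂ × ℂ} (hp : p ∈ U)
    (w : ℂ × ℂ) : leviForm f p w
    = 4 * (w.1 * conj w.1 * dz₁ (dzbar₁ f) p + w.2 * conj w.2 * dz₂ (dzbar₂ f) p
      + w.2 * conj w.1 * dzbar₁ (dz₂ f) p + w.1 * conj w.2 * dz₁ (dzbar₂ f) p) := by
  have hs := fderiv_fderiv_symm hU hf hp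
  have e1 : dz₁ (dzbar₁ f) p = (fderiv ℝ (dzbar₁ f) p (1, 0)
    - Complex.I * fderiv ℝ (dzbar₁ f) p (Complex.I • (1, 0))) / 2 := rfl
  have e2 : dz₂ (dzbar₂ f) p = (fderiv ℝ (dzbar₂ f) p (0, 1)
    - Complex.I * fderiv ℝ (dzbar₂ f) p (Complex.I • (0, 1))) / 2 := rfl
  have e3 : dzbar₁ (dz₂ f) p = (fderiv ℝ (dz₂ f) p (1, 0)
    + Complex.I * fderiv ℝ (dz₂ f) p (Complex.I • (1, 0))) / 2 := rfl
  have e4 : dz₁ (dzbar₂ f) p = (fderiv ℝ (dzbar₂ f) p (1, 0)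
    - Complex.I * fderiv ℝ (dzbar₂ f) p (Complex.I • (1, 0))) / 2 := rfl
  rw [e1, e2, e3, e4]
  simp only [dzbar₁, dz₂, dzbar₂, fderiv_wirtinger hU hf hp, fderiv_wirtingerBar hU hf hp]
  rw [leviForm, I_smul_eq_real_combination w]
  conv_lhs => enter [1]; rw [eq_real_combination w]
  generalize fderiv ℝ (fderiv ℝ f) p = B at *
  obtain ⟨⟨a, b⟩, ⟨c, d⟩⟩ := w
  have e1 : (⟨a, b⟩ : ℂ) = a + b * Complex.I := Complex.mk_eq_add_mul_I a b
  have e2 : (⟨c, d⟩ : ℂ) = c + d * Complex.I := Complex.mk_eq_add_mul_I c d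
  simp only [e1, e2, map_add (starRingEnd ℂ), map_mul, Complex.conj_I, Complex.conj_ofReal]
  generalize ((1 : ℂ), (0 : ℂ)) = v₁ at *
  generalize ((0 : ℂ), (1 : ℂ)) = v₂ at *
  have h1 := hs (Complex.I • v₁) v₁
  have h2 := hs (Complex.I • v₂) v₂
  have h3 := hs v₂ v₁
  have h4 := hs v₂ (Complex.I • v₁)
  have h5 := hs (Complex.I • v₂) v₁
  have h6 := hs (Complex.I • v₂) (Complex.I • v₁)
  generalize Complex.I • v₁ = u₁ at *
  generalize Complex.I • v₂ = u₂ at *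
  have hB : ∀ (r : ℝ) x, B (r • x) = r • B x := fun r x => B.map_smul r x
  have hB' : ∀ (r : ℝ) x y, B x (r • y) = r • B x y := fun r x y => (B x).map_smul r y
  simp only [map_add, add_apply, hB, hB', smul_apply, Complex.real_smul, h1, h2, h3, h4, h5, h6]
  push_cast
  have hI := Complex.I_sq
  generalize Complex.I = i at *
  grind

end Wirtinger

/-! ### The Cayley transform -/

/-- The Cayley transform from the unit ball onto the Siegel domain that maps `0` to `Z`. -/
noncomputable def cayley (Z ζ : ℂ × ℂ) : ℂ × ℂ :=
  ((rho Z : ℂ) / (1 + ζ.1) - conj Z.1 + conj Z.2 * (Z.2 + (√(rho Z) : ℂ) * ζ.2 / (1 + ζ.1)),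
    Z.2 + (√(rho Z) : ℂ) * ζ.2 / (1 + ζ.1))

/-- The derivative of `cayley Z` at `ζ` in the direction `v`. -/
noncomputable def cayleyDeriv (Z ζ v : ℂ × ℂ) : ℂ × ℂ :=
  ((-(rho Z : ℂ) * v.1 + conj Z.2 * (√(rho Z) : ℂ) * (v.2 * (1 + ζ.1) - ζ.2 * v.1)) / (1 + ζ.1) ^ 2,
    (√(rho Z) : ℂ) * (v.2 * (1 + ζ.1) - ζ.2 * v.1) / (1 + ζ.1) ^ 2)

/-- The unimodular factor `(|q| / q)^(2k)` with `q = 1 + ζ₁`, written with a branch of the logarithm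
so that it can be differentiated for half-integral `k`. -/
noncomputable def phase (k : ℝ) (ζ : ℂ × ℂ) : ℂ :=
  Complex.exp (k * (conj (Complex.log (1 + ζ.1)) - Complex.log (1 + ζ.1)))

/-- The function on the unit ball that corresponds to the function `f` of weight `k` on the Siegel
domain; its value at `0` is `f Z`. -/
noncomputable def pullback (k : ℝ) (Z : ℂ × ℂ) (f : ℂ × ℂ → ℂ) (ζ : ℂ × ℂ) : ℂ :=
  phase k ζ * f (cayley Z ζ)

theorem one_add_re_pos {ζ : ℂ × ℂ} (hζ : ζ ∈ unitBall) : 0 < (1 + ζ.1).re := by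
  have h : Complex.normSq ζ.1 + Complex.normSq ζ.2 < 1 := hζ
  have h2 := Complex.normSq_nonneg ζ.2
  rw [Complex.normSq_apply] at h
  rw [Complex.add_re, Complex.one_re]
  nlinarith [mul_self_nonneg ζ.1.im]

theorem one_add_ne_zero {ζ : ℂ × ℂ} (hζ : ζ ∈ unitBall) : 1 + ζ.1 ≠ 0 := fun h => by
  have := one_add_re_pos hζ
  simp [h] at this

theorem conj_one_add_ne_zero {ζ : ℂ × ℂ} (hζ : ζ ∈ unitBall) : 1 + conj ζ.1 ≠ 0 := by
  have := (map_ne_zero (starRingEnd ℂ)).2 (one_add_ne_zero hζ)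
  simpa using this

theorem one_add_mem_slitPlane {ζ : ℂ × ℂ} (hζ : ζ ∈ unitBall) : 1 + ζ.1 ∈ Complex.slitPlane :=
  Or.inl (one_add_re_pos hζ)

theorem nsq_coe (ζ : ℂ × ℂ) : (nsq ζ : ℂ) = ζ.1 * conj ζ.1 + ζ.2 * conj ζ.2 := by
  simp [nsq, Complex.mul_conj]

theorem rho_coe (Z : ℂ × ℂ) : (rho Z : ℂ) = conj Z.1 + Z.1 - conj Z.2 * Z.2 := by
  rw [← rhoPair_self]; rfl

theorem sqrt_rho_sq {Z : ℂ × ℂ} (hZ : Z ∈ domain) : (√(rho Z) : ℂ) ^ 2 = rho Z := by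
  have h : 0 < rho Z := hZ
  rw [← Complex.ofReal_pow, Real.sq_sqrt h.le]

theorem isOpen_domain : IsOpen domain := by
  refine isOpen_lt continuous_const ?_
  unfold rho
  fun_prop

theorem rho_cayley_coe {Z ζ : ℂ × ℂ} (hZ : Z ∈ domain) (hζ : ζ ∈ unitBall) :
    (rho (cayley Z ζ) : ℂ) = rho Z * (1 - nsq ζ) / ((1 + ζ.1) * (1 + conj ζ.1)) := by
  have hq := one_add_ne_zero hζ
  have hq' := conj_one_add_ne_zero hζ
  have hs := sqrt_rho_sq hZ
  have hr := rho_coe Z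
  rw [rho_coe (cayley Z ζ), nsq_coe]
  simp only [cayley, map_add, map_sub, map_mul, map_div₀, map_one, Complex.conj_conj,
    Complex.conj_ofReal]
  generalize (rho Z : ℂ) = ρ at *
  generalize (√(rho Z) : ℂ) = s at *
  field_simp
  grind

theorem rho_cayley {Z ζ : ℂ × ℂ} (hZ : Z ∈ domain) (hζ : ζ ∈ unitBall) :
    rho (cayley Z ζ) = rho Z * (1 - nsq ζ) / Complex.normSq (1 + ζ.1) := by
  have h := rho_cayley_coe hZ hζ
  have e : (1 + ζ.1) * (1 + conj ζ.1) = (Complex.normSq (1 + ζ.1) : ℂ) := by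
    rw [← Complex.mul_conj]; simp
  rw [e] at h
  exact_mod_cast h

theorem cayley_mem {Z ζ : ℂ × ℂ} (hZ : Z ∈ domain) (hζ : ζ ∈ unitBall) : cayley Z ζ ∈ domain := by
  change 0 < rho (cayley Z ζ)
  rw [rho_cayley hZ hζ]
  have h1 : 0 < rho Z := hZ
  have h2 : 0 < 1 - nsq ζ := sub_pos.2 hζ
  have h3 := Complex.normSq_pos.2 (one_add_ne_zero hζ)
  positivity

theorem cayley_zero (Z : ℂ × ℂ) : cayley Z 0 = Z := by
  ext1
  · simp [cayley, rho_coe]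
    ring
  · simp [cayley]

theorem rhoPair_cayley {Z ζ : ℂ × ℂ} : rhoPair Z (cayley Z ζ) = rho Z / (1 + ζ.1) := by
  simp only [rhoPair, cayley]
  ring

section Derivatives

variable {Z ζ v : ℂ × ℂ} {t : ℝ}

theorem hasDerivAt_fst_line (ζ v : ℂ × ℂ) (t : ℝ) :
    HasDerivAt (fun t : ℝ => 1 + (ζ + t • v).1) v.1 t := by
  have h : HasDerivAt (fun t : ℝ => (t : ℂ) * v.1) (1 * v.1) t :=
    (Complex.ofRealCLM.hasDerivAt (x := t)).mul_const v.1
  simpa [add_assoc] using (h.const_add ζ.1).const_add 1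

theorem hasDerivAt_snd_line (ζ v : ℂ × ℂ) (t : ℝ) :
    HasDerivAt (fun t : ℝ => (ζ + t • v).2) v.2 t := by
  have h : HasDerivAt (fun t : ℝ => (t : ℂ) * v.2) (1 * v.2) t :=
    (Complex.ofRealCLM.hasDerivAt (x := t)).mul_const v.2
  simpa using h.const_add ζ.2

theorem hasDerivAt_cayley_line (h : 1 + (ζ + t • v).1 ≠ 0) :
    HasDerivAt (fun t : ℝ => cayley Z (ζ + t • v)) (cayleyDeriv Z (ζ + t • v) v) t := by
  have h1 := hasDerivAt_fst_line ζ v t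
  have h2 := (((hasDerivAt_snd_line ζ v t).const_mul (√(rho Z) : ℂ)).div h1 h).const_add Z.2
  have h3 := (((hasDerivAt_const t (rho Z : ℂ)).div h1 h).sub_const (conj Z.1)).add
    (h2.const_mul (conj Z.2))
  refine (h3.prodMk h2).congr_deriv ?_
  ext1
  · simp only [cayleyDeriv]
    field_simp
    ring
  · simp only [cayleyDeriv]
    field_simp

/-- Complex lines are mapped by the projective map `cayley Z` into complex lines, so the second
derivative along a line is a multiple of the first. -/
theorem hasDerivAt_cayleyDeriv_line (h : 1 + (ζ + t • v).1 ≠ 0) :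
    HasDerivAt (fun t : ℝ => cayleyDeriv Z (ζ + t • v) v)
      ((-2 * (v.1 / (1 + (ζ + t • v).1))) • cayleyDeriv Z (ζ + t • v) v) t := by
  have h1 := hasDerivAt_fst_line ζ v t
  have h2 := ((h1.const_mul v.2).sub ((hasDerivAt_snd_line ζ v t).mul_const v.1))
  have h3 := (h2.const_mul (√(rho Z) : ℂ)).div (h1.pow 2) (pow_ne_zero 2 h)
  have h4 := (((h2.const_mul (conj Z.2 * (√(rho Z) : ℂ))).const_add (-(rho Z : ℂ) * v.1)).div
    (h1.pow 2) (pow_ne_zero 2 h))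
  refine (h4.prodMk h3).congr_deriv ?_
  ext1
  · simp only [cayleyDeriv, Prod.smul_fst, smul_eq_mul, Pi.pow_apply, Pi.sub_apply]
    field_simp
    ring
  · simp only [cayleyDeriv, Prod.smul_snd, smul_eq_mul, Pi.pow_apply, Pi.sub_apply]
    field_simp
    ring

theorem hasDerivAt_conj {g : ℝ → ℂ} {g' : ℂ} (h : HasDerivAt g g' t) :
    HasDerivAt (fun t => conj (g t)) (conj g') t :=
  Complex.conjCLE.toContinuousLinearMap.hasFDerivAt.comp_hasDerivAt t h

theorem hasDerivAt_phase_line (k : ℝ) (h : ζ + t • v ∈ unitBall) :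
    HasDerivAt (fun t : ℝ => phase k (ζ + t • v)) (phase k (ζ + t • v)
      * (k * (conj (v.1 / (1 + (ζ + t • v).1)) - v.1 / (1 + (ζ + t • v).1)))) t := by
  have h1 := (hasDerivAt_fst_line ζ v t).clog_real (one_add_mem_slitPlane h)
  exact (((hasDerivAt_conj h1).sub h1).const_mul (k : ℂ)).cexp

theorem hasDerivAt_div_line (h : 1 + (ζ + t • v).1 ≠ 0) :
    HasDerivAt (fun t : ℝ => v.1 / (1 + (ζ + t • v).1)) (-(v.1 / (1 + (ζ + t • v).1)) ^ 2) t := by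
  refine ((hasDerivAt_const t v.1).div (hasDerivAt_fst_line ζ v t) h).congr_deriv ?_
  field_simp
  ring

end Derivatives

theorem contDiffOn_cayley (Z : ℂ × ℂ) : ContDiffOn ℝ 2 (cayley Z) unitBall := by
  have h0 : ∀ ζ ∈ unitBall, 1 + ζ.1 ≠ 0 := fun ζ hζ => one_add_ne_zero hζ
  have h1 : ContDiffOn ℝ 2 (fun ζ : ℂ × ℂ => 1 + ζ.1) unitBall := by fun_prop
  have hinv : ContDiffOn ℝ 2 (fun ζ : ℂ × ℂ => (1 + ζ.1)⁻¹) unitBall := h1.inv h0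
  have h2 : ContDiffOn ℝ 2 (fun ζ : ℂ × ℂ => Z.2 + (√(rho Z) : ℂ) * ζ.2 / (1 + ζ.1)) unitBall := by
    simp only [div_eq_mul_inv]
    exact contDiffOn_const.add ((contDiffOn_const.mul contDiff_snd.contDiffOn).mul hinv)
  have h3 : ContDiffOn ℝ 2 (fun ζ : ℂ × ℂ => (rho Z : ℂ) / (1 + ζ.1)) unitBall := by
    simp only [div_eq_mul_inv]
    exact contDiffOn_const.mul hinv
  exact ((h3.sub contDiffOn_const).add (contDiffOn_const.mul h2)).prodMk h2

theorem contDiffOn_phase (k : ℝ) : ContDiffOn ℝ 2 (phase k) unitBall := by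
  have h1 : ContDiffOn ℝ 2 (fun ζ : ℂ × ℂ => 1 + ζ.1) unitBall := by fun_prop
  have h2 : ContDiffOn ℝ 2 (fun ζ : ℂ × ℂ => Complex.log (1 + ζ.1)) unitBall := fun ζ hζ =>
    ((Complex.contDiffAt_log (one_add_mem_slitPlane hζ)).restrict_scalars ℝ).comp_contDiffWithinAt
      (f := fun ζ : ℂ × ℂ => 1 + ζ.1) ζ (h1 ζ hζ)
  have h3 : ContDiffOn ℝ 2 (fun ζ : ℂ × ℂ => conj (Complex.log (1 + ζ.1))) unitBall :=
    Complex.conjCLE.contDiff.comp_contDiffOn h2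
  exact (contDiffOn_const.mul (h3.sub h2)).cexp

theorem contDiffOn_pullback (k : ℝ) {Z : ℂ × ℂ} (hZ : Z ∈ domain) {f : ℂ × ℂ → ℂ}
    (hf : ContDiffOn ℝ 2 f domain) : ContDiffOn ℝ 2 (pullback k Z f) unitBall :=
  (contDiffOn_phase k).mul (hf.comp (contDiffOn_cayley Z) fun _ hζ => cayley_mem hZ hζ)

/-- The first two derivatives of a `C²` function along a line are determined by its restriction to
the line. -/
theorem fderiv_eq_of_hasDerivAt_line {F : ℂ × ℂ → ℂ} {U : Set (ℂ × ℂ)} (hU : IsOpen U)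
    (hF : ContDiffOn ℝ 2 F U) {p v : ℂ × ℂ} (hp : p ∈ U) {g' : ℝ → ℂ} {a : ℂ}
    (hg : ∀ t : ℝ, p + t • v ∈ U → HasDerivAt (fun t : ℝ => F (p + t • v)) (g' t) t)
    (hg' : HasDerivAt g' a 0) :
    fderiv ℝ F p v = g' 0 ∧ fderiv ℝ (fderiv ℝ F) p v v = a := by
  have hline : ∀ t : ℝ, HasDerivAt (fun t : ℝ => p + t • v) v t := fun t => by
    simpa using ((hasDerivAt_id t).smul_const v).const_add p
  have hmem : ∀ᶠ t in 𝓝 (0 : ℝ), p + t • v ∈ U :=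
    (hline 0).continuousAt.eventually_mem (by simpa using hU.mem_nhds hp)
  have heq : ∀ t : ℝ, p + t • v ∈ U → fderiv ℝ F (p + t • v) v = g' t := fun t ht =>
    (hasDerivAt_comp_curve hU hF (hline t) ht).unique (hg t ht)
  have h0 : p + (0 : ℝ) • v ∈ U := by simpa using hp
  have h2 := hasDerivAt_fderiv_comp_curve hU hF (γ' := fun _ => v) (hline 0)
    (hasDerivAt_const 0 v) h0
  have h3 := hg'.congr_of_eventuallyEq (hmem.mono fun t ht => heq t ht)
  have h4 := h2.unique h3
  exact ⟨by simpa using heq 0 h0, by simpa using h4⟩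

theorem fderiv_pullback (k : ℝ) {Z : ℂ × ℂ} (hZ : Z ∈ domain) {f : ℂ × ℂ → ℂ}
    (hf : ContDiffOn ℝ 2 f domain) {ζ : ℂ × ℂ} (hζ : ζ ∈ unitBall) (v : ℂ × ℂ) {μ ε : ℂ}
    (hμ : μ = v.1 / (1 + ζ.1)) (hε : ε = k * (conj μ - μ)) {W w : ℂ × ℂ} (hW : W = cayley Z ζ)
    (hw : w = cayleyDeriv Z ζ v) :
    fderiv ℝ (pullback k Z f) ζ v = phase k ζ * (ε * f W + fderiv ℝ f W w) ∧
    fderiv ℝ (fderiv ℝ (pullback k Z f)) ζ v v = phase k ζ *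
      (fderiv ℝ (fderiv ℝ f) W w w + fderiv ℝ f W ((-2 * μ) • w) + 2 * ε * fderiv ℝ f W w
        + (ε ^ 2 + k * (μ ^ 2 - conj μ ^ 2)) * f W) := by
  have hD : ∀ t : ℝ, ζ + t • v ∈ unitBall → HasDerivAt (fun t : ℝ => f (cayley Z (ζ + t • v)))
      (fderiv ℝ f (cayley Z (ζ + t • v)) (cayleyDeriv Z (ζ + t • v) v)) t := fun t ht =>
    hasDerivAt_comp_curve isOpen_domain hf (γ := fun t : ℝ => cayley Z (ζ + t • v))
      (hasDerivAt_cayley_line (one_add_ne_zero ht)) (cayley_mem hZ ht)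
  have h0 : ζ + (0 : ℝ) • v ∈ unitBall := by simpa using hζ
  have hD2 := hasDerivAt_fderiv_comp_curve isOpen_domain hf
    (γ := fun t : ℝ => cayley Z (ζ + t • v)) (γ' := fun t : ℝ => cayleyDeriv Z (ζ + t • v) v)
    (hasDerivAt_cayley_line (one_add_ne_zero h0))
    (hasDerivAt_cayleyDeriv_line (one_add_ne_zero h0)) (cayley_mem hZ h0)
  have hm := hasDerivAt_div_line (one_add_ne_zero h0)
  have he := ((hasDerivAt_conj hm).sub hm).const_mul (k : ℂ)
  have hp := hasDerivAt_phase_line k h0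
  have key := fderiv_eq_of_hasDerivAt_line isOpen_unitBall (contDiffOn_pullback k hZ hf) hζ (v := v)
    (fun t ht => (hasDerivAt_phase_line k ht).mul (hD t ht))
    (((hp.mul he).mul (hD 0 h0)).add (hp.mul hD2))
  simp only [zero_smul, add_zero, Pi.mul_apply, Pi.sub_apply] at key
  rw [← hW, ← hw, ← hμ, ← hε] at key
  refine ⟨key.1.trans (by ring), key.2.trans ?_⟩
  rw [map_neg, map_pow]
  ring

/-! ### Transport of the Laplacian to the ball -/

theorem cayleyDeriv_smul (Z ζ v : ℂ × ℂ) (c : ℂ) :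
    cayleyDeriv Z ζ (c • v) = c • cayleyDeriv Z ζ v := by
  ext1
  · simp only [cayleyDeriv, Prod.smul_fst, Prod.smul_snd, smul_eq_mul]
    ring
  · simp only [cayleyDeriv, Prod.smul_fst, Prod.smul_snd, smul_eq_mul]
    ring

/-- Transformation of the Levi form. The terms in `k` come from the phase. -/
theorem leviForm_pullback (k : ℝ) {Z : ℂ × ℂ} (hZ : Z ∈ domain) {f : ℂ × ℂ → ℂ}
    (hf : ContDiffOn ℝ 2 f domain) {ζ : ℂ × ℂ} (hζ : ζ ∈ unitBall) (v : ℂ × ℂ) {μ : ℂ}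
    (hμ : μ = v.1 / (1 + ζ.1)) {W w : ℂ × ℂ} (hW : W = cayley Z ζ)
    (hw : w = cayleyDeriv Z ζ v) :
    leviForm (pullback k Z f) ζ v = phase k ζ * (leviForm f W w
      + 2 * k * ((conj μ - μ) * fderiv ℝ f W w
        - Complex.I * (conj μ + μ) * fderiv ℝ f W (Complex.I • w))
      - 4 * (k : ℂ) ^ 2 * μ * conj μ * f W) := by
  have h1 := (fderiv_pullback k hZ hf hζ v hμ rfl hW hw).2
  have hμ' : Complex.I * μ = (Complex.I • v).1 / (1 + ζ.1) := by
    rw [hμ, Prod.smul_fst, smul_eq_mul]; ring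
  have h2 := (fderiv_pullback k hZ hf hζ (Complex.I • v) hμ' rfl hW
    (w := Complex.I • w) (by rw [hw, cayleyDeriv_smul])).2
  -- The second derivative of a holomorphic map changes sign under `v ↦ i v`, so it drops out of the
  -- Levi form.
  have hneg : (-2 * (Complex.I * μ)) • Complex.I • w = -((-2 * μ) • w) := by
    rw [smul_smul, ← neg_smul]
    congr 1
    linear_combination (-2 * μ) * Complex.I_sq
  rw [leviForm, leviForm, h1, h2, hneg, map_neg, map_mul, Complex.conj_I]
  linear_combination (phase k ζ * ((k : ℂ) ^ 2 * (conj μ + μ) ^ 2 * f W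
    + k * (μ ^ 2 - conj μ ^ 2) * f W)) * Complex.I_sq

/-- The weighted Laplacian of the Siegel domain becomes the weighted invariant Laplacian of the ball:
both sides are compared coefficient by coefficient, as combinations of Wirtinger derivatives of `f`
at the image point. -/
theorem ballEigenfunction_pullback {k : ℝ} {eigval : ℂ} {f : ℂ × ℂ → ℂ}
    (hf : ContDiffOn ℝ 2 f domain) (h : ∀ Z ∈ domain, laplacian k f Z = eigval * f Z)
    {Z : ℂ × ℂ} (hZ : Z ∈ domain) : BallEigenfunction k eigval (pullback k Z f) := by
  intro r hr x hx
  have hζ : r • x ∈ unitBall := by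
    change nsq (r • x) < 1
    rw [nsq_smul, hx]
    nlinarith [hr.1, hr.2]
  obtain ⟨W, hW⟩ : ∃ W, W = cayley Z (r • x) := ⟨_, rfl⟩
  have hWmem : W ∈ domain := hW ▸ cayley_mem hZ hζ
  have hlap := h W hWmem
  rw [leviForm_pullback k hZ hf hζ x rfl hW rfl, leviForm_pullback k hZ hf hζ (perp x) rfl hW rfl,
    (fderiv_pullback k hZ hf hζ (Complex.I • (r • x)) rfl rfl hW rfl).1]
  have hpull : pullback k Z f (r • x) = phase k (r • x) * f W := by rw [hW]; rfl
  rw [hpull]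
  rw [leviForm_eq_wirtinger isOpen_domain hf hWmem, leviForm_eq_wirtinger isOpen_domain hf hWmem]
  simp only [fderiv_eq_wirtinger f W]
  have hρ := rho_cayley_coe hZ hζ
  rw [← hW, nsq_smul, hx] at hρ
  have hq := one_add_ne_zero hζ
  have hq' := conj_one_add_ne_zero hζ
  have hs := sqrt_rho_sq hZ
  have hrZ := rho_coe Z
  rw [← hs] at hrZ hρ
  have hx' : x.1 * conj x.1 + x.2 * conj x.2 = 1 := by
    rw [← nsq_coe, hx, Complex.ofReal_one]
  obtain ⟨x₁, x₂⟩ := x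
  obtain ⟨a₁, a₂⟩ := Z
  have hW1 : W.1 = _ := congrArg Prod.fst hW
  have hW2 : W.2 = _ := congrArg Prod.snd hW
  rw [laplacian, hρ, hW1, hW2] at hlap
  simp only [cayley, cayleyDeriv, perp_apply, Prod.smul_fst, Prod.smul_snd, smul_eq_mul,
    Complex.real_smul, map_add, map_sub, map_mul, map_div₀, map_neg, map_pow, map_one,
    Complex.conj_conj, Complex.conj_ofReal, Complex.conj_I, ← hs] at *
  generalize (√(rho (a₁, a₂)) : ℂ) = s at *
  generalize conj x₁ = y₁ at *
  generalize conj x₂ = y₂ at *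
  generalize conj a₁ = b₁ at *
  generalize conj a₂ = b₂ at *
  have i22 := identity_22 (s := s) hx' hq hq'
  have i21 := identity_21 (s := s) (b := a₂) hx' hq hq'
  have hx'' : y₁ * x₁ + y₂ * x₂ = 1 := by rw [← hx']; ring
  have i12 := identity_21 (s := s) (b := b₂) hx'' hq' hq
  have i11 := identity_11 (s := s) (b := a₂) (b' := b₂) hx' hq hq'
  have j1 := identity_1 (s := s) (b' := b₂) hx' hq hq'
  have j1' := identity_1 (s := s) (b' := a₂) hx'' hq' hq
  have j2 := identity_2 (y := x₂) (s := s) hq hq'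
  have j2' := identity_2 (y := y₂) (s := s) hq' hq
  have j0 := identity_0 hx' hq hq'
  rw [mul_comm (1 + (r : ℂ) * y₁) (1 + (r : ℂ) * x₁)] at i12 j1'
  have e1 : x₂ * (1 + r * x₁) - r * x₂ * x₁ = x₂ := by ring
  have e2 : y₂ * (1 + r * y₁) - r * y₂ * y₁ = y₂ := by ring
  -- On the unit sphere the derivative in the direction `perp x` simplifies.
  have e3 : y₁ * (1 + r * x₁) - r * x₂ * -y₂ = y₁ + r := by linear_combination (r : ℂ) * hx'
  have e4 : x₁ * (1 + r * y₁) - r * y₂ * -x₂ = x₁ + r := by linear_combination (r : ℂ) * hx'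
  have e5 : (-s ^ 2 * (Complex.I * (r * x₁)) + b₂ * s * (Complex.I * (r * x₂) * (1 + r * x₁)
      - r * x₂ * (Complex.I * (r * x₁)))) / (1 + r * x₁) ^ 2
      = Complex.I * r * ((-s ^ 2 * x₁ + b₂ * s * x₂) / (1 + r * x₁) ^ 2) := by ring
  have e6 : (-s ^ 2 * (-Complex.I * (r * y₁)) + a₂ * s * (-Complex.I * (r * y₂) * (1 + r * y₁)
      - r * y₂ * (-Complex.I * (r * y₁)))) / (1 + r * y₁) ^ 2
      = -Complex.I * r * ((-s ^ 2 * y₁ + a₂ * s * y₂) / (1 + r * y₁) ^ 2) := by ring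
  have e7 : s * (Complex.I * (r * x₂) * (1 + r * x₁) - r * x₂ * (Complex.I * (r * x₁)))
      / (1 + r * x₁) ^ 2 = Complex.I * r * (s * x₂ / (1 + r * x₁) ^ 2) := by ring
  have e8 : s * (-Complex.I * (r * y₂) * (1 + r * y₁) - r * y₂ * (-Complex.I * (r * y₁)))
      / (1 + r * y₁) ^ 2 = -Complex.I * r * (s * y₂ / (1 + r * y₁) ^ 2) := by ring
  have e9 : (k : ℂ) * (-Complex.I * (r * y₁) / (1 + r * y₁) - Complex.I * (r * x₁) / (1 + r * x₁))
      = -Complex.I * k * r * (y₁ / (1 + r * y₁) + x₁ / (1 + r * x₁)) := by ring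
  have e10 : -s ^ 2 * -y₂ = s ^ 2 * y₂ := by ring
  have e11 : -s ^ 2 * -x₂ = s ^ 2 * x₂ := by ring
  rw [e5, e6, e7, e8, e9, e1, e2, e3, e4, e10, e11]
  have e12 : s ^ 2 / (1 + r * x₁) - b₁ + b₂ * (a₂ + s * (r * x₂) / (1 + r * x₁))
      + (s ^ 2 / (1 + r * y₁) - a₁ + a₂ * (b₂ + s * (r * y₂) / (1 + r * y₁)))
      = s ^ 2 / (1 + r * x₁) + s ^ 2 / (1 + r * y₁) - (s ^ 2 + a₂ * b₂)
        + b₂ * (a₂ + s * (r * x₂) / (1 + r * x₁)) + a₂ * (b₂ + s * (r * y₂) / (1 + r * y₁)) := by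
    linear_combination hrZ
  rw [e12] at hlap
  push_cast at hlap
  rw [mul_one] at hlap
  -- Every coefficient becomes an atom, so that the goal is linear in the identities above.
  generalize s ^ 2 / (1 + r * x₁) + s ^ 2 / (1 + r * y₁) - (s ^ 2 + a₂ * b₂)
        + b₂ * (a₂ + s * (r * x₂) / (1 + r * x₁)) + a₂ * (b₂ + s * (r * y₂) / (1 + r * y₁)) = T at *
  generalize a₂ + s * (r * x₂) / (1 + r * x₁) = W₂ at *
  generalize b₂ + s * (r * y₂) / (1 + r * y₁) = V₂ at *
  generalize s ^ 2 * (1 - (r : ℂ) ^ 2) / ((1 + r * x₁) * (1 + r * y₁)) = ρ at *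
  generalize (-s ^ 2 * x₁ + b₂ * s * x₂) / (1 + r * x₁) ^ 2 = w₁ at *
  generalize (-s ^ 2 * y₁ + a₂ * s * y₂) / (1 + r * y₁) ^ 2 = w₁' at *
  generalize s * x₂ / (1 + r * x₁) ^ 2 = w₂ at *
  generalize s * y₂ / (1 + r * y₁) ^ 2 = w₂' at *
  generalize (s ^ 2 * y₂ + b₂ * s * (y₁ + r)) / (1 + r * x₁) ^ 2 = u₁ at *
  generalize (s ^ 2 * x₂ + a₂ * s * (x₁ + r)) / (1 + r * y₁) ^ 2 = u₁' at *
  generalize s * (y₁ + r) / (1 + r * x₁) ^ 2 = u₂ at *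
  generalize s * (x₁ + r) / (1 + r * y₁) ^ 2 = u₂' at *
  generalize x₁ / (1 + r * x₁) = μ at *
  generalize y₁ / (1 + r * y₁) = μ' at *
  generalize -y₂ / (1 + r * x₁) = ν at *
  generalize -x₂ / (1 + r * y₁) = ν' at *
  generalize phase k (r • (x₁, x₂)) = E at *
  generalize dz₁ (dzbar₁ f) W = A at *
  generalize dz₂ (dzbar₂ f) W = B at *
  generalize dzbar₁ (dz₂ f) W = C at *
  generalize dz₁ (dzbar₂ f) W = D at *
  generalize dz₁ f W = p₁ at *
  generalize dzbar₁ f W = p₁' at *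
  generalize dz₂ f W = p₂ at *
  generalize dzbar₂ f W = p₂' at *
  -- The multiple of `I ^ 2 + 1` collects the products of two factors `I` in the first-order terms.
  linear_combination (4 * E) * hlap + (4 * E) * (A * i11 + B * i22 + C * i21 + D * i12)
    + (4 * k * E) * (p₁ * j1 - p₁' * j1') + (4 * k * E * (1 - (r : ℂ) ^ 2)) * (p₂ * j2 - p₂' * j2')
    + (4 * (k : ℂ) ^ 2 * E * f W * (1 - (r : ℂ) ^ 2)) * j0
    + ((1 - (r : ℂ) ^ 2) * E * (-2 * k * (1 - (r : ℂ) ^ 2) * (μ' + μ)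
        * (w₁ * p₁ - w₁' * p₁' + w₂ * p₂ - w₂' * p₂')
      - 2 * k * (ν' + ν) * (u₁ * p₁ - u₁' * p₁' + u₂ * p₂ - u₂' * p₂')
      + 4 * (k : ℂ) ^ 2 * r * (μ' + μ) * f W
      - 4 * k * r * (w₁ * p₁ - w₁' * p₁' + w₂ * p₂ - w₂' * p₂'))) * Complex.I_sq

/-! ### Transport of the integral operator to the ball -/

/-- The inverse of the Cayley transform `cayley Z`. -/
noncomputable def cayleyInv (Z W : ℂ × ℂ) : ℂ × ℂ :=
  ((rho Z : ℂ) / rhoPair Z W - 1, (√(rho Z) : ℂ) * (W.2 - Z.2) / rhoPair Z W)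

/-- The real part of `2 ρ(Z, W)` is `ρ(Z) + ρ(W) + |z₂ - w₂|²`. -/
theorem rhoPair_ne_zero {Z W : ℂ × ℂ} (hZ : Z ∈ domain) (hW : W ∈ domain) : rhoPair Z W ≠ 0 := by
  intro h
  have hre := congrArg Complex.re h
  have h1 : 0 < 2 * Z.1.re - Complex.normSq Z.2 := hZ
  have h2 : 0 < 2 * W.1.re - Complex.normSq W.2 := hW
  simp only [rhoPair, Complex.add_re, Complex.sub_re, Complex.mul_re, Complex.conj_re,
    Complex.conj_im, Complex.zero_re] at hre
  rw [Complex.normSq_apply] at h1 h2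
  nlinarith [sq_nonneg (Z.2.re - W.2.re), sq_nonneg (Z.2.im - W.2.im)]

theorem nsq_cayleyInv {Z W : ℂ × ℂ} (hZ : Z ∈ domain) (hW : W ∈ domain) :
    nsq (cayleyInv Z W) = 1 - rho Z * rho W / Complex.normSq (rhoPair Z W) := by
  have hs := sqrt_rho_sq hZ
  have hP := rhoPair_ne_zero hZ hW
  have hP' : conj (rhoPair Z W) ≠ 0 := (map_ne_zero (starRingEnd ℂ)).2 hP
  have e : (nsq (cayleyInv Z W) : ℂ)
      = 1 - rho Z * rho W / (rhoPair Z W * conj (rhoPair Z W)) := by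
    rw [nsq_coe]
    simp only [cayleyInv, map_sub, map_mul, map_div₀, map_one, Complex.conj_ofReal]
    have hd : rhoPair Z W + conj (rhoPair Z W)
        = rho Z + rho W + (W.2 - Z.2) * (conj W.2 - conj Z.2) := by
      rw [rho_coe, rho_coe, rhoPair]
      simp only [map_add, map_sub, map_mul, Complex.conj_conj]
      ring
    generalize rhoPair Z W = P at *
    generalize conj P = P' at *
    generalize (√(rho Z) : ℂ) = s at *
    generalize (rho Z : ℂ) = a at *
    generalize (rho W : ℂ) = b at *
    field_simp
    linear_combination (W.2 - Z.2) * (conj W.2 - conj Z.2) * hs - a * hd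
  rw [Complex.mul_conj] at e
  exact_mod_cast e

theorem cayleyInv_mem {Z W : ℂ × ℂ} (hZ : Z ∈ domain) (hW : W ∈ domain) :
    cayleyInv Z W ∈ unitBall := by
  change nsq (cayleyInv Z W) < 1
  rw [nsq_cayleyInv hZ hW]
  have h1 : 0 < rho Z := hZ
  have h2 : 0 < rho W := hW
  have h3 := Complex.normSq_pos.2 (rhoPair_ne_zero hZ hW)
  have : 0 < rho Z * rho W / Complex.normSq (rhoPair Z W) := by positivity
  linarith

theorem rho_coe_ne_zero {Z : ℂ × ℂ} (hZ : Z ∈ domain) : (rho Z : ℂ) ≠ 0 := by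
  have h : 0 < rho Z := hZ
  exact_mod_cast h.ne'

theorem cayley_cayleyInv {Z W : ℂ × ℂ} (hZ : Z ∈ domain) (hW : W ∈ domain) :
    cayley Z (cayleyInv Z W) = W := by
  have hs := sqrt_rho_sq hZ
  have hP := rhoPair_ne_zero hZ hW
  have hρ := rho_coe_ne_zero hZ
  have h2 : (cayley Z (cayleyInv Z W)).2 = W.2 := by
    simp only [cayley, cayleyInv, add_sub_cancel]
    field_simp
    linear_combination (W.2 - Z.2) * hs
  have h1 : (cayley Z (cayleyInv Z W)).1
      = (rho Z : ℂ) / (1 + (cayleyInv Z W).1) - conj Z.1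
        + conj Z.2 * (cayley Z (cayleyInv Z W)).2 := rfl
  refine Prod.ext ?_ h2
  rw [h1, h2]
  simp only [cayleyInv, add_sub_cancel]
  rw [div_div_cancel₀ hρ, rhoPair]
  ring

theorem cayleyInv_cayley {Z ζ : ℂ × ℂ} (hZ : Z ∈ domain) (hζ : ζ ∈ unitBall) :
    cayleyInv Z (cayley Z ζ) = ζ := by
  have hs := sqrt_rho_sq hZ
  have hρ := rho_coe_ne_zero hZ
  have hq := one_add_ne_zero hζ
  ext1
  · simp only [cayleyInv, rhoPair_cayley]
    field_simp
    ring
  · have h2 : (cayley Z ζ).2 - Z.2 = (√(rho Z) : ℂ) * ζ.2 / (1 + ζ.1) := add_sub_cancel_left _ _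
    simp only [cayleyInv, rhoPair_cayley, h2]
    rw [← hs] at hρ ⊢
    have hs0 : (√(rho Z) : ℂ) ≠ 0 := fun h => hρ (by simp [h])
    field_simp

theorem injOn_cayley {Z : ℂ × ℂ} (hZ : Z ∈ domain) : InjOn (cayley Z) unitBall :=
  fun ζ hζ η hη h => by rw [← cayleyInv_cayley hZ hζ, h, cayleyInv_cayley hZ hη]

theorem image_cayley {Z : ℂ × ℂ} (hZ : Z ∈ domain) : cayley Z '' unitBall = domain := by
  ext W
  constructor
  · rintro ⟨ζ, hζ, rfl⟩
    exact cayley_mem hZ hζ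
  · exact fun hW => ⟨cayleyInv Z W, cayleyInv_mem hZ hW, cayley_cayleyInv hZ hW⟩

/-- `cayleyDeriv` as a complex linear map. -/
noncomputable def cayleyDerivLinear (Z ζ : ℂ × ℂ) : (ℂ × ℂ) →ₗ[ℂ] (ℂ × ℂ) where
  toFun := cayleyDeriv Z ζ
  map_add' v w := by
    ext1
    · simp only [cayleyDeriv, Prod.fst_add, Prod.snd_add]; ring
    · simp only [cayleyDeriv, Prod.fst_add, Prod.snd_add]; ring
  map_smul' c v := cayleyDeriv_smul Z ζ v c

theorem det_cayleyDerivLinear {Z ζ : ℂ × ℂ} (hζ : ζ ∈ unitBall) :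
    LinearMap.det (cayleyDerivLinear Z ζ) = -(rho Z : ℂ) * √(rho Z) / (1 + ζ.1) ^ 3 := by
  have hq := one_add_ne_zero hζ
  rw [← LinearMap.det_toMatrix (Module.Basis.finTwoProd ℂ), Matrix.det_fin_two]
  simp only [LinearMap.toMatrix_apply, Module.Basis.finTwoProd_zero, Module.Basis.finTwoProd_one,
    Module.Basis.coe_finTwoProd_repr, cayleyDerivLinear, LinearMap.coe_mk, AddHom.coe_mk,
    cayleyDeriv, Matrix.cons_val_zero, Matrix.cons_val_one]
  field_simp
  ring

theorem fderiv_cayley {Z ζ : ℂ × ℂ} (hζ : ζ ∈ unitBall) :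
    ((fderiv ℝ (cayley Z) ζ : (ℂ × ℂ) →L[ℝ] (ℂ × ℂ)) : (ℂ × ℂ) →ₗ[ℝ] (ℂ × ℂ))
      = (cayleyDerivLinear Z ζ).restrictScalars ℝ := by
  have hopen := isOpen_unitBall.mem_nhds hζ
  have hd := (((contDiffOn_cayley Z).differentiableOn (by norm_num)).differentiableAt
    hopen).hasFDerivAt
  refine LinearMap.ext fun v => ?_
  have hline : HasDerivAt (fun t : ℝ => ζ + t • v) v 0 := by
    simpa using ((hasDerivAt_id (0 : ℝ)).smul_const v).const_add ζ
  have hq : 1 + (ζ + (0 : ℝ) • v).1 ≠ 0 := by simpa using one_add_ne_zero hζ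
  have h1 : HasDerivAt (fun t : ℝ => cayley Z (ζ + t • v)) (fderiv ℝ (cayley Z) ζ v) 0 :=
    HasFDerivAt.comp_hasDerivAt (l := cayley Z) (f := fun t : ℝ => ζ + t • v) 0
      (by simpa using hd) hline
  have h2 := h1.unique (hasDerivAt_cayley_line hq)
  rw [zero_smul, add_zero] at h2
  exact h2

theorem abs_det_fderiv_cayley {Z ζ : ℂ × ℂ} (hZ : Z ∈ domain) (hζ : ζ ∈ unitBall) :
    |(fderiv ℝ (cayley Z) ζ).det| = rho Z ^ 3 / Complex.normSq (1 + ζ.1) ^ 3 := by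
  have h0 : 0 < rho Z := hZ
  rw [ContinuousLinearMap.det, fderiv_cayley hζ, LinearMap.det_restrictScalars,
    det_cayleyDerivLinear hζ, Algebra.norm_complex_apply, abs_of_nonneg (Complex.normSq_nonneg _)]
  simp only [map_div₀, map_mul, map_pow, Complex.normSq_neg, Complex.normSq_ofReal]
  rw [Real.mul_self_sqrt h0.le]
  ring

/-- The invariant measure in the coordinates of the ball. -/
theorem abs_det_mul_density {Z ζ : ℂ × ℂ} (hZ : Z ∈ domain) (hζ : ζ ∈ unitBall) :
    |(fderiv ℝ (cayley Z) ζ).det| * (4 / rho (cayley Z ζ) ^ 3) = 4 / (1 - nsq ζ) ^ 3 := by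
  rw [abs_det_fderiv_cayley hZ hζ, rho_cayley hZ hζ]
  have h1 : rho Z ≠ 0 := ne_of_gt hZ
  have h2 : 1 - nsq ζ ≠ 0 := (sub_pos.2 hζ).ne'
  have h3 := (Complex.normSq_pos.2 (one_add_ne_zero hζ)).ne'
  field_simp

theorem H_cayley {k : ℝ} {m : ℤ} (hkm : 2 * k = m) {Z ζ : ℂ × ℂ} (hZ : Z ∈ domain)
    (hζ : ζ ∈ unitBall) : H m Z (cayley Z ζ) = phase k ζ := by
  have h0 : 0 < rho Z := hZ
  have hρ := rho_coe_ne_zero hZ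
  have hq := one_add_ne_zero hζ
  have hn : (‖1 + ζ.1‖ : ℂ) ≠ 0 := by exact_mod_cast norm_ne_zero_iff.2 hq
  have hkm' : (2 : ℂ) * k = m := by exact_mod_cast congrArg (Complex.ofReal) hkm
  -- `conj L - L = 2 (Re L - L)`, and `2 k = m` makes the exponent an integral multiple of `Re L - L`.
  have hL : conj (Complex.log (1 + ζ.1)) - Complex.log (1 + ζ.1)
      = 2 * ((Real.log ‖1 + ζ.1‖ : ℝ) - Complex.log (1 + ζ.1)) := by
    rw [← Complex.log_re]
    have h := Complex.add_conj (Complex.log (1 + ζ.1))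
    push_cast at h
    linear_combination h
  rw [phase, hL, show (k : ℂ) * (2 * ((Real.log ‖1 + ζ.1‖ : ℝ) - Complex.log (1 + ζ.1)))
    = m * ((Real.log ‖1 + ζ.1‖ : ℝ) - Complex.log (1 + ζ.1)) by rw [← hkm']; ring,
    Complex.exp_int_mul, Complex.exp_sub, Complex.exp_log hq, ← Complex.ofReal_exp,
    Real.exp_log (norm_pos_iff.2 hq), H, rhoPair_cayley, ← div_zpow]
  congr 1
  rw [norm_div, Complex.norm_real, Real.norm_eq_abs, abs_of_pos h0]
  push_cast
  field_simp

theorem u_cayley {Z ζ : ℂ × ℂ} (hZ : Z ∈ domain) (hζ : ζ ∈ unitBall) :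
    u Z (cayley Z ζ) = 1 / (1 - nsq ζ) - 1 := by
  have h0 : 0 < rho Z := hZ
  have h2 : 1 - nsq ζ ≠ 0 := (sub_pos.2 hζ).ne'
  have h3 := (Complex.normSq_pos.2 (one_add_ne_zero hζ)).ne'
  rw [u, rhoPair_cayley, rho_cayley hZ hζ, ← Complex.normSq_eq_norm_sq, map_div₀,
    Complex.normSq_ofReal]
  have := h0.ne'
  field_simp

theorem measurable_density : Measurable fun Z : ℂ × ℂ => ENNReal.ofReal (4 / rho Z ^ 3) := by
  have h : Continuous rho := by
    unfold rho
    fun_prop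
  exact ENNReal.measurable_ofReal.comp (measurable_const.div (h.measurable.pow_const 3))

theorem toReal_density {W : ℂ × ℂ} (hW : W ∈ domain) :
    (ENNReal.ofReal (4 / rho W ^ 3)).toReal = 4 / rho W ^ 3 := by
  have h : 0 < rho W := hW
  exact ENNReal.toReal_ofReal (by positivity)

theorem hasFDerivWithinAt_cayley (Z : ℂ × ℂ) : ∀ ζ ∈ unitBall,
    HasFDerivWithinAt (cayley Z) (fderiv ℝ (cayley Z) ζ) unitBall ζ := fun _ hζ =>
  (((contDiffOn_cayley Z).differentiableOn (by norm_num)).differentiableAt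
    (isOpen_unitBall.mem_nhds hζ)).hasFDerivAt.hasFDerivWithinAt

theorem abs_det_smul_density_smul {Z : ℂ × ℂ} (hZ : Z ∈ domain) (g : ℂ × ℂ → ℂ) {ζ : ℂ × ℂ}
    (hζ : ζ ∈ unitBall) : |(fderiv ℝ (cayley Z) ζ).det| •
      ((ENNReal.ofReal (4 / rho (cayley Z ζ) ^ 3)).toReal • g (cayley Z ζ))
      = (4 / (1 - nsq ζ) ^ 3 : ℝ) • g (cayley Z ζ) := by
  rw [toReal_density (cayley_mem hZ hζ), smul_smul, abs_det_mul_density hZ hζ]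

theorem integrable_dm_iff {Z : ℂ × ℂ} (hZ : Z ∈ domain) (g : ℂ × ℂ → ℂ) :
    Integrable g dm ↔
      IntegrableOn (fun ζ => (4 / (1 - nsq ζ) ^ 3 : ℝ) • g (cayley Z ζ)) unitBall := by
  rw [dm, integrable_withDensity_iff_integrable_smul' measurable_density
    (Eventually.of_forall fun _ => ENNReal.ofReal_lt_top)]
  rw [← IntegrableOn, ← image_cayley hZ,
    integrableOn_image_iff_integrableOn_abs_det_fderiv_smul volume isOpen_unitBall.measurableSet
    (hasFDerivWithinAt_cayley Z) (injOn_cayley hZ)]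
  exact integrableOn_congr_fun (fun ζ hζ => abs_det_smul_density_smul hZ g hζ)
    isOpen_unitBall.measurableSet

theorem integral_dm {Z : ℂ × ℂ} (hZ : Z ∈ domain) (g : ℂ × ℂ → ℂ) :
    ∫ W, g W ∂dm = ∫ ζ in unitBall, (4 / (1 - nsq ζ) ^ 3 : ℝ) • g (cayley Z ζ) := by
  rw [dm, integral_withDensity_eq_integral_toReal_smul measurable_density
    (Eventually.of_forall fun _ => ENNReal.ofReal_lt_top), ← image_cayley hZ,
    integral_image_eq_integral_abs_det_fderiv_smul volume isOpen_unitBall.measurableSet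
    (hasFDerivWithinAt_cayley Z) (injOn_cayley hZ)]
  exact setIntegral_congr_fun isOpen_unitBall.measurableSet
    fun ζ hζ => abs_det_smul_density_smul hZ g hζ

/-- The radial weight on the ball that corresponds to the kernel with profile `Φ`. -/
noncomputable def radialWeight (Φ : ℝ → ℂ) (n : ℝ) : ℂ :=
  (4 / (1 - n) ^ 3 : ℝ) * Φ (1 / (1 - n) - 1)

theorem smul_kernel_cayley (Φ : ℝ → ℂ) {k : ℝ} {m : ℤ} (hkm : 2 * k = m) {Z ζ : ℂ × ℂ}
    (hZ : Z ∈ domain) (hζ : ζ ∈ unitBall) (f : ℂ × ℂ → ℂ) :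
    (4 / (1 - nsq ζ) ^ 3 : ℝ) • (K Φ m Z (cayley Z ζ) * f (cayley Z ζ))
      = radialWeight Φ (nsq ζ) * pullback k Z f ζ := by
  rw [K, H_cayley hkm hZ hζ, u_cayley hZ hζ, radialWeight, pullback, Complex.real_smul]
  ring

/-- The weight of a compactly supported profile lives on a closed ball of radius less than one. -/
theorem exists_radialWeight_support {Φ : ℝ → ℂ} (hΦ : HasCompactSupport Φ) :
    ∃ R < 1, ∀ n < 1, R < n → radialWeight Φ n = 0 := by
  obtain ⟨C, hC⟩ := hΦ.isCompact.isBounded.subset_closedBall (0 : ℝ)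
  have hC' : 0 < |C| + 1 := by positivity
  refine ⟨1 - 1 / (|C| + 1), by linarith [one_div_pos.2 hC'], fun n hn hR => ?_⟩
  have hn' : 0 < 1 - n := by linarith
  have h1 : |C| + 1 < 1 / (1 - n) := by
    rw [lt_one_div hC' hn']
    linarith
  have h2 : Φ (1 / (1 - n) - 1) = 0 := by
    by_contra h
    have := hC (subset_tsupport Φ h)
    rw [mem_closedBall_zero_iff, Real.norm_eq_abs] at this
    linarith [le_abs_self (1 / (1 - n) - 1), le_abs_self C]
  rw [radialWeight, h2, mul_zero]

theorem continuousOn_radialWeight {Φ : ℝ → ℂ} (hΦ : Continuous Φ) {R : ℝ} (hR : R < 1) :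
    ContinuousOn (radialWeight Φ) (Icc 0 R) := by
  have h0 : ∀ n ∈ Icc 0 R, 1 - n ≠ 0 := fun n hn => by linarith [hn.2]
  have h1 : ContinuousOn (fun n : ℝ => 1 - n) (Icc 0 R) := by fun_prop
  refine ContinuousOn.mul (Complex.continuous_ofReal.comp_continuousOn ?_)
    (hΦ.comp_continuousOn ?_)
  · exact continuousOn_const.div (h1.pow 3) fun n hn => pow_ne_zero 3 (h0 n hn)
  · exact (continuousOn_const.div h1 h0).sub continuousOn_const

/-- The integral operator in the coordinates of the ball: integration of the pullback against a
radial weight supported on a compact ball. -/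
theorem integrable_and_L_eq {Φ : ℝ → ℂ} (hΦ : Continuous Φ) {R : ℝ} (hR : R < 1)
    (hsupp : ∀ n < 1, R < n → radialWeight Φ n = 0) {k : ℝ} {m : ℤ} (hkm : 2 * k = m)
    {Z : ℂ × ℂ} (hZ : Z ∈ domain) {f : ℂ × ℂ → ℂ} (hf : ContDiffOn ℝ 2 f domain) :
    Integrable (fun W => K Φ m Z W * f W) dm ∧
      L Φ m f Z = ∫ ζ in nsq ⁻¹' Iic R, radialWeight Φ (nsq ζ) * pullback k Z f ζ := by
  have hsub : nsq ⁻¹' Iic R ⊆ unitBall := fun ζ hζ => lt_of_le_of_lt hζ hR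
  have hzero : ∀ ζ ∈ unitBall \ nsq ⁻¹' Iic R, radialWeight Φ (nsq ζ) * pullback k Z f ζ = 0 :=
    fun ζ hζ => by rw [hsupp _ hζ.1 (not_le.1 hζ.2), zero_mul]
  have hcongr : EqOn (fun ζ => (4 / (1 - nsq ζ) ^ 3 : ℝ) • (K Φ m Z (cayley Z ζ) * f (cayley Z ζ)))
      (fun ζ => radialWeight Φ (nsq ζ) * pullback k Z f ζ) unitBall :=
    fun ζ hζ => smul_kernel_cayley Φ hkm hZ hζ f
  constructor
  · rw [integrable_dm_iff hZ, integrableOn_congr_fun hcongr isOpen_unitBall.measurableSet]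
    refine IntegrableOn.of_forall_sdiff_eq_zero (s := nsq ⁻¹' Iic R) ?_
      isOpen_unitBall.measurableSet hzero
    refine ContinuousOn.integrableOn_compact (isCompact_nsq_le R) (ContinuousOn.mul ?_ ?_)
    · exact (continuousOn_radialWeight hΦ hR).comp continuous_nsq.continuousOn
        fun ζ hζ => ⟨nsq_nonneg ζ, hζ⟩
    · exact (contDiffOn_pullback k hZ hf).continuousOn.mono hsub
  · rw [L, integral_dm hZ, setIntegral_congr_fun isOpen_unitBall.measurableSet hcongr]
    exact setIntegral_eq_of_subset_of_forall_sdiff_eq_zero isOpen_unitBall.measurableSet hsub hzero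

/-- An eigenfunction on the ball that vanishes at the centre has integral zero against the radial
weights. -/
theorem setIntegral_radialWeight_eq_zero {Φ : ℝ → ℂ} (hΦ : Continuous Φ) {R : ℝ} (hR : R < 1)
    {k : ℝ} {eigval : ℂ} {F : ℂ × ℂ → ℂ} (hF : ContDiffOn ℝ 2 F unitBall)
    (h : BallEigenfunction k eigval F) (h0 : F 0 = 0) :
    ∫ ζ in nsq ⁻¹' Iic R, radialWeight Φ (nsq ζ) * F ζ = 0 :=
  setIntegral_radial_mul_eq_zero hF.continuousOn (fun _ hr => sphereMean_eq_zero hF h h0 hr) hR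
    (continuousOn_radialWeight hΦ hR)

theorem pullback_zero (k : ℝ) (Z : ℂ × ℂ) (f : ℂ × ℂ → ℂ) : pullback k Z f 0 = f Z := by
  simp [pullback, phase, cayley_zero]

theorem ballEigenfunction_sub_const_mul {k : ℝ} {eigval : ℂ} {F G : ℂ × ℂ → ℂ}
    (hF : ContDiffOn ℝ 2 F unitBall) (hG : ContDiffOn ℝ 2 G unitBall)
    (hF' : BallEigenfunction k eigval F) (hG' : BallEigenfunction k eigval G) (c : ℂ) :
    BallEigenfunction k eigval (F - c • G) := by
  have h1 : ∀ p ∈ unitBall, fderiv ℝ (F - c • G) p = fderiv ℝ F p - c • fderiv ℝ G p := fun p hp =>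
    ((hasFDerivAt_of_contDiffOn isOpen_unitBall hF hp).sub
      ((hasFDerivAt_of_contDiffOn isOpen_unitBall hG hp).const_smul c)).fderiv
  have h2 : ∀ p ∈ unitBall, fderiv ℝ (fderiv ℝ (F - c • G)) p
      = fderiv ℝ (fderiv ℝ F) p - c • fderiv ℝ (fderiv ℝ G) p := fun p hp => by
    have heq : fderiv ℝ (F - c • G) =ᶠ[𝓝 p] fderiv ℝ F - c • fderiv ℝ G :=
      (isOpen_unitBall.eventually_mem hp).mono h1
    rw [heq.fderiv_eq]
    exact ((hasFDerivAt_fderiv_of_contDiffOn isOpen_unitBall hF hp).sub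
      ((hasFDerivAt_fderiv_of_contDiffOn isOpen_unitBall hG hp).const_smul c)).fderiv
  intro r hr x hx
  have hmem : r • x ∈ unitBall := by
    change nsq (r • x) < 1
    rw [nsq_smul, hx]
    nlinarith [hr.1, hr.2]
  simp only [leviForm, h2 _ hmem, h1 _ hmem, sub_apply, smul_apply, smul_eq_mul, Pi.sub_apply,
    Pi.smul_apply]
  have e1 := hF' r hr x hx
  have e2 := hG' r hr x hx
  simp only [leviForm] at e1 e2
  linear_combination e1 - c * e2

/-- The ratio of `L f (Z)` to `f (Z)` is the same for all eigenfunctions `f` and points `Z`. -/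
theorem L_mul_eq_L_mul {Φ : ℝ → ℂ} (hΦ : Continuous Φ) (hΦ' : HasCompactSupport Φ) {k : ℝ}
    {m m₀ : ℤ} (hkm : 2 * k = m) (hkm₀ : 2 * k = m₀) {eigval : ℂ} {f f₀ : ℂ × ℂ → ℂ}
    (hf : ContDiffOn ℝ 2 f domain) (hf₀ : ContDiffOn ℝ 2 f₀ domain)
    (h : ∀ Z ∈ domain, laplacian k f Z = eigval * f Z)
    (h₀ : ∀ Z ∈ domain, laplacian k f₀ Z = eigval * f₀ Z) {Z Z₀ : ℂ × ℂ} (hZ : Z ∈ domain)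
    (hZ₀ : Z₀ ∈ domain) (hne : f₀ Z₀ ≠ 0) :
    L Φ m f Z = L Φ m₀ f₀ Z₀ / f₀ Z₀ * f Z := by
  obtain ⟨R, hR, hsupp⟩ := exists_radialWeight_support hΦ'
  have hF := contDiffOn_pullback k hZ hf
  have hF₀ := contDiffOn_pullback k hZ₀ hf₀
  set c := f Z / f₀ Z₀ with hc
  have hzero : (pullback k Z f - c • pullback k Z₀ f₀) 0 = 0 := by
    simp only [Pi.sub_apply, Pi.smul_apply, pullback_zero, smul_eq_mul, hc]
    field_simp
    ring
  have key := setIntegral_radialWeight_eq_zero hΦ hR (hF.sub (hF₀.const_smul c))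
    (ballEigenfunction_sub_const_mul hF hF₀ (ballEigenfunction_pullback hf h hZ)
      (ballEigenfunction_pullback hf₀ h₀ hZ₀) c) hzero
  have hint : ∀ G : ℂ × ℂ → ℂ, ContDiffOn ℝ 2 G unitBall →
      IntegrableOn (fun ζ => radialWeight Φ (nsq ζ) * G ζ) (nsq ⁻¹' Iic R) := fun G hG =>
    ContinuousOn.integrableOn_compact (isCompact_nsq_le R)
      (((continuousOn_radialWeight hΦ hR).comp continuous_nsq.continuousOn
        fun ζ hζ => ⟨nsq_nonneg ζ, hζ⟩).mul
      (hG.continuousOn.mono fun ζ hζ => lt_of_le_of_lt hζ hR))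
  rw [(integrable_and_L_eq hΦ hR hsupp hkm hZ hf).2, (integrable_and_L_eq hΦ hR hsupp hkm₀ hZ₀ hf₀).2]
  simp only [smul_eq_mul, mul_sub] at key
  rw [integral_sub (hint _ hF)] at key
  · simp only [mul_left_comm _ c] at key
    rw [integral_const_mul] at key
    rw [sub_eq_zero.1 key, hc]
    ring
  · simpa only [mul_left_comm _ c] using (hint _ hF₀).const_mul c

theorem L_eq_zero {Φ : ℝ → ℂ} (hΦ : Continuous Φ) (hΦ' : HasCompactSupport Φ) {k : ℝ}
    {m : ℤ} (hkm : 2 * k = m) {eigval : ℂ} {f : ℂ × ℂ → ℂ} (hf : ContDiffOn ℝ 2 f domain)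
    (h : ∀ Z ∈ domain, laplacian k f Z = eigval * f Z) {Z : ℂ × ℂ} (hZ : Z ∈ domain)
    (h0 : f Z = 0) : L Φ m f Z = 0 := by
  obtain ⟨R, hR, hsupp⟩ := exists_radialWeight_support hΦ'
  rw [(integrable_and_L_eq hΦ hR hsupp hkm hZ hf).2]
  exact setIntegral_radialWeight_eq_zero hΦ hR (contDiffOn_pullback k hZ hf)
    (ballEigenfunction_pullback hf h hZ) (by rw [pullback_zero, h0])

/-- The condition that `c` is the ratio `L f (Z) / f (Z)` for some eigenfunction `f` and some point
`Z` with `f (Z) ≠ 0`. -/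
def IsEigenvalueRatio (Φ : ℝ → ℂ) (k : ℝ) (eigval c : ℂ) : Prop :=
  ∃ (m : ℤ) (f : ℂ × ℂ → ℂ) (Z : ℂ × ℂ), 2 * k = m ∧ ContDiffOn ℝ 2 f domain ∧
    (∀ W ∈ domain, laplacian k f W = eigval * f W) ∧ Z ∈ domain ∧ f Z ≠ 0 ∧ c = L Φ m f Z / f Z

end SU21

theorem theorem2p5 :
    ∃ Λ : (ℝ → ℂ) → ℝ → ℂ → ℂ,
      ∀ Φ : ℝ → ℂ, ContDiff ℝ 2 Φ → HasCompactSupport Φ →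
        ∀ (k : ℝ) (m : ℤ), 2 * k = (m : ℝ) →
          ∀ (eigval : ℂ) (f : ℂ × ℂ → ℂ), ContDiffOn ℝ 2 f SU21.domain →
            (∀ Z ∈ SU21.domain, SU21.laplacian k f Z = eigval * f Z) →
              ∀ Z ∈ SU21.domain,
                MeasureTheory.Integrable (fun W => SU21.K Φ m Z W * f W) SU21.dm ∧
                  SU21.L Φ m f Z = Λ Φ k eigval * f Z := by
  classical
  refine ⟨fun Φ k eigval => Classical.epsilon (SU21.IsEigenvalueRatio Φ k eigval), ?_⟩
  intro Φ hΦ hΦ' k m hkm eigval f hf h Z hZ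
  obtain ⟨R, hR, hsupp⟩ := SU21.exists_radialWeight_support hΦ'
  refine ⟨(SU21.integrable_and_L_eq hΦ.continuous hR hsupp hkm hZ hf).1, ?_⟩
  rcases eq_or_ne (f Z) 0 with h0 | h0
  · rw [SU21.L_eq_zero hΦ.continuous hΦ' hkm hf h hZ h0, h0, mul_zero]
  · obtain ⟨m₀, f₀, Z₀, hkm₀, hf₀, h₀, hZ₀, hne, hc⟩ := Classical.epsilon_spec
      (p := SU21.IsEigenvalueRatio Φ k eigval) ⟨_, m, f, Z, hkm, hf, h, hZ, h0, rfl⟩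
    simp only [hc]
    exact SU21.L_mul_eq_L_mul hΦ.continuous hΦ' hkm hkm₀ hf hf₀ h h₀ hZ hZ₀ hne
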